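/- **The calculus.** Terms of the $\lambda\Pi$-calculus modulo theory are $t,u ::= c \mid x \mid \mathtt{TYPE} \mid \mathtt{KIND} \mid \Pi x{:}t.\,u \mid \lambda x{:}t.\,u \mid t\,u$ (up to renaming of bound variables), and $t\to u$ is a non-dependent product. For a set $\mathcal R$ of rewriting rules, $\equiv_{\beta\mathcal R}$ is the congruence generated by $\beta$-reduction and by the substitution instances of the rules of $\mathcal R$. For a signature $\Sigma$ (a list of declarations $c:A$) the judgements "$\Gamma$ well-formed" and $\Gamma\vdash t:A$ are defined inductively by the following rules, where $s$ is a sort ($\mathtt{TYPE}$ or $\mathtt{KIND}$): the empty context is well-formed; if $\Gamma\vdash A:s$ then $\Gamma,x{:}A$ is well-formed; if $\Gamma$ is well-formed then $\Gamma\vdash\mathtt{TYPE}:\mathtt{KIND}$, $\Gamma\vdash x:A$ for $x{:}A\in\Gamma$, and $\Gamma\vdash c:A$ for $c{:}A\in\Sigma$ with $\vdash A:s$; if $\Gamma\vdash A:\mathtt{TYPE}$ and $\Gamma,x{:}A\vdash B:s$ then $\Gamma\vdash\Pi x{:}A.\,B:s$, and if moreover $\Gamma,x{:}A\vdash t:B$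 then $\Gamma\vdash\lambda x{:}A.\,t:\Pi x{:}A.\,B$; if $\Gamma\vdash t:\Pi x{:}A.\,B$ and $\Gamma\vdash u:A$ then $\Gamma\vdash t\,u:(u/x)B$; if $\Gamma\vdash t:A$, $\Gamma\vdash B:s$ and $A\equiv_{\beta\mathcal R}B$ then $\Gamma\vdash t:B$. **The theory.** Let $\Sigma_M,\mathcal R_M$ be given by the declarations $I:\mathtt{TYPE}$, $\mathit{Set}:\mathtt{TYPE}$, $\mathit{El}:\mathit{Set}\to\mathtt{TYPE}$, $\iota:\mathit{Set}$, $\mathit{Prop}:\mathtt{TYPE}$, $\mathit{Prf}:\mathit{Prop}\to\mathtt{TYPE}$, ${\Rightarrow}:\mathit{Prop}\to\mathit{Prop}\to\mathit{Prop}$, $\forall:\Pi x{:}\mathit{Set}.\,(\mathit{El}\,x\to\mathit{Prop})\to\mathit{Prop}$ and the rules $\mathit{El}\,\iota\hookrightarrow I$, $\mathit{Prf}\,(x\Rightarrow y)\hookrightarrow\mathit{Prf}\,x\to\mathit{Prf}\,y$, $\mathit{Prf}\,(\forall\,x\,p)\hookrightarrow\Pi z{:}\mathit{El}\,x.\,\mathit{Prf}\,(p\,z)$.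 **The logic.** Let $\mathcal L$ be a first-order language. Propositions of minimal predicate logic in $\mathcal L$ are built from atoms $P(t_1,\dots,t_k)$ with $\Rightarrow$ and $\forall$, over an infinite supply of variables; provability of sequents is given by natural deduction (axiom, introduction and elimination of $\Rightarrow$ and of $\forall$, with the usual eigenvariable condition). Terms and propositions are translated to $\lambda\Pi$ terms in the natural way: $f(t_1,\dots,t_k)$ to $f\,t_1\cdots t_k$, $P(t_1,\dots,t_k)$ to $P\,t_1\cdots t_k$, $A\Rightarrow B$ to ${\Rightarrow}\,A\,B$, and $\forall z\,A$ to $\forall\,\iota\,(\lambda z{:}I.\,A)$; the same notation is used for a proposition and its translation. **Theorem.** Let $A_1,\dots,A_n\vdash B$ be a sequent of minimal predicate logic in $\mathcal L$. Let $\Gamma_{\mathcal L}$ be a context that declares, for function symbols $f$ of $\mathcal L$, a variable $f:I\to\dots\to I\to I$ and, for predicate symbols $P$ of $\mathcal L$, a variable $P:I\to\dots\to I\to\mathit{Prop}$ (with as many arguments as the arity), each symbol at most once: all symbols of $\mathcal L$ if $\mathcal L$ is finite, and in general any finite set of symbols of $\mathcal L$ that contains those occurring in the sequent. Let $\Delta$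 be a context that declares finitely many distinct variables of type $I$, among them every variable free in the sequent. Let $\Delta'$ be a context that declares, for each hypothesis $A_i$, a variable $a_i:\mathit{Prf}\,A_i$. 1. Suppose that $\Delta$ is not empty or that $\Gamma_{\mathcal L}$ declares a function symbol of arity $0$. Then $A_1,\dots,A_n\vdash B$ has a proof in minimal predicate logic if and only if there is a term $\pi$ with $\Gamma_{\mathcal L},\Delta,\Delta'\vdash_{\Sigma_M,\mathcal R_M}\pi:\mathit{Prf}\,B$. 2. The "if" direction holds without this assumption. -/

import Mathlib

universe u v

/-! ## The λΠ-calculus modulo theory -/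

namespace LPi

/-- The two sorts `TYPE` and `KIND`. -/
inductive Srt : Type
  | type
  | kind

/-- Terms over a set `C` of constants, with de Bruijn indices: `pi A B` and `lam A t` bind the
index `0` in `B` and in `t`. -/
inductive Tm (C : Type) : Type
  | const (c : C)
  | var (i : ℕ)
  | sort (s : Srt)
  | pi (A B : Tm C)
  | lam (A t : Tm C)
  | app (t u : Tm C)

namespace Tm

variable {C : Type}

/-- The renaming `ξ` pushed under a binder. -/
def upRen (ξ : ℕ → ℕ) : ℕ → ℕ
  | 0 => 0
  | i + 1 => ξ i + 1

def rename : (ℕ → ℕ) → Tm C → Tm C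
  | _, const c => const c
  | ξ, var i => var (ξ i)
  | _, sort s => sort s
  | ξ, pi A B => pi (A.rename ξ) (B.rename (upRen ξ))
  | ξ, lam A t => lam (A.rename ξ) (t.rename (upRen ξ))
  | ξ, app t u => app (t.rename ξ) (u.rename ξ)

/-- The substitution `θ` pushed under a binder. -/
def up (θ : ℕ → Tm C) : ℕ → Tm C
  | 0 => var 0
  | i + 1 => (θ i).rename Nat.succ

/-- Simultaneous capture-avoiding substitution. -/
def subst : (ℕ → Tm C) → Tm C → Tm C
  | _, const c => const c
  | θ, var i => θ i
  | _, sort s => sort s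
  | θ, pi A B => pi (A.subst θ) (B.subst (up θ))
  | θ, lam A t => lam (A.subst θ) (t.subst (up θ))
  | θ, app t u => app (t.subst θ) (u.subst θ)

/-- `B.inst u` is `(u/x)B`, where `x` is the variable of index `0` of `B`. -/
def inst (B u : Tm C) : Tm C :=
  B.subst fun i => match i with
    | 0 => u
    | j + 1 => var j

/-- The non-dependent product `A → B`. -/
def arrow (A B : Tm C) : Tm C :=
  pi A (B.rename Nat.succ)

/-- `t u₁ … uₖ`. -/
def apps (t : Tm C) (us : List (Tm C)) : Tm C :=
  us.foldl app t

end Tm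

/-- One step of `↪_{βR}`, for a set `R` of rewriting rules `ℓ ↪ r` given as pairs of terms, whose
free variables are the variables of the rule. -/
inductive Step {C : Type} (R : Set (Tm C × Tm C)) : Tm C → Tm C → Prop
  | beta (A t u : Tm C) : Step R (.app (.lam A t) u) (t.inst u)
  | rule (l r : Tm C) (θ : ℕ → Tm C) : (l, r) ∈ R → Step R (l.subst θ) (r.subst θ)
  | piLeft {A A' : Tm C} (B : Tm C) : Step R A A' → Step R (.pi A B) (.pi A' B)
  | piRight (A : Tm C) {B B' : Tm C} : Step R B B' → Step R (.pi A B) (.pi A B')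
  | lamLeft {A A' : Tm C} (t : Tm C) : Step R A A' → Step R (.lam A t) (.lam A' t)
  | lamRight (A : Tm C) {t t' : Tm C} : Step R t t' → Step R (.lam A t) (.lam A t')
  | appLeft {t t' : Tm C} (u : Tm C) : Step R t t' → Step R (.app t u) (.app t' u)
  | appRight (t : Tm C) {u u' : Tm C} : Step R u u' → Step R (.app t u) (.app t u')

/-- The congruence `≡_{βR}`. -/
def Conv {C : Type} (R : Set (Tm C × Tm C)) : Tm C → Tm C → Prop :=
  Relation.EqvGen (Step R)

/-- A signature: a list of declarations `c : A`. -/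
abbrev Signature (C : Type) : Type := List (C × Tm C)

/-- A context: a list of types, the most recent declaration first. The type at position `i` is
a term over the declarations that follow it in the list. -/
abbrev Ctx (C : Type) : Type := List (Tm C)

mutual

/-- `⊢_{Σ,R} Γ well-formed`. -/
inductive WellFormed {C : Type} (S : Signature C) (R : Set (Tm C × Tm C)) : Ctx C → Prop
  | empty : WellFormed S R []
  | decl {Γ : Ctx C} {A : Tm C} {s : Srt} :
      Typing S R Γ A (.sort s) → WellFormed S R (A :: Γ)

/-- `Γ ⊢_{Σ,R} t : A`. -/
inductive Typing {C : Type} (S : Signature C) (R : Set (Tm C × Tm C)) :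
    Ctx C → Tm C → Tm C → Prop
  | sort {Γ : Ctx C} : WellFormed S R Γ → Typing S R Γ (.sort .type) (.sort .kind)
  | const {Γ : Ctx C} {c : C} {A : Tm C} {s : Srt} :
      WellFormed S R Γ → Typing S R [] A (.sort s) → (c, A) ∈ S → Typing S R Γ (.const c) A
  | var {Γ : Ctx C} {i : ℕ} {A : Tm C} :
      WellFormed S R Γ → Γ[i]? = some A → Typing S R Γ (.var i) (A.rename (· + (i + 1)))
  | prod {Γ : Ctx C} {A B : Tm C} {s : Srt} :
      Typing S R Γ A (.sort .type) → Typing S R (A :: Γ) B (.sort s) →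
      Typing S R Γ (.pi A B) (.sort s)
  | abs {Γ : Ctx C} {A B t : Tm C} {s : Srt} :
      Typing S R Γ A (.sort .type) → Typing S R (A :: Γ) B (.sort s) →
      Typing S R (A :: Γ) t B → Typing S R Γ (.lam A t) (.pi A B)
  | app {Γ : Ctx C} {A B t u : Tm C} :
      Typing S R Γ t (.pi A B) → Typing S R Γ u A → Typing S R Γ (.app t u) (B.inst u)
  | conv {Γ : Ctx C} {A B t : Tm C} {s : Srt} :
      Typing S R Γ t A → Typing S R Γ B (.sort s) → Conv R A B → Typing S R Γ t B

end

/-! ## The sub-theory "Minimal predicate logic" -/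

/-- The constants `I`, `Set`, `El`, `ι`, `Prop`, `Prf`, `⇒`, `∀`. -/
inductive Cst : Type
  | I
  | set
  | El
  | iota
  | prop
  | Prf
  | imp
  | all

namespace Min

def tI : Tm Cst := .const .I
def tSet : Tm Cst := .const .set
def tEl (a : Tm Cst) : Tm Cst := .app (.const .El) a
def tIota : Tm Cst := .const .iota
def tProp : Tm Cst := .const .prop
def tPrf (p : Tm Cst) : Tm Cst := .app (.const .Prf) p
def tImp (p q : Tm Cst) : Tm Cst := .app (.app (.const .imp) p) q
def tAll (a p : Tm Cst) : Tm Cst := .app (.app (.const .all) a) p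

/-- The signature `Σ_M`. -/
def sig : Signature Cst :=
  [ (.I, .sort .type),
    (.set, .sort .type),
    (.El, .arrow tSet (.sort .type)),
    (.iota, tSet),
    (.prop, .sort .type),
    (.Prf, .arrow tProp (.sort .type)),
    (.imp, .arrow tProp (.arrow tProp tProp)),
    (.all, .pi tSet (.arrow (.arrow (tEl (.var 0)) tProp) tProp)) ]

/-- The rewriting rules `R_M`:
`El ι ↪ I`, `Prf (x ⇒ y) ↪ Prf x → Prf y` and `Prf (∀ x p) ↪ Π z : El x, Prf (p z)`,
where the variables `x, y` and `x, p` of the last two rules are those of indices `0, 1`. -/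
def rules : Set (Tm Cst × Tm Cst) :=
  { (tEl tIota, tI),
    (tPrf (tImp (.var 0) (.var 1)), .arrow (tPrf (.var 0)) (tPrf (.var 1))),
    (tPrf (tAll (.var 0) (.var 1)),
      .pi (tEl (.var 0)) (tPrf (.app (.var 2) (.var 0)))) }

end Min

end LPi

/-! ## Minimal predicate logic in natural deduction -/

namespace MinLogic

/-- Propositions of minimal predicate logic in the language `L`. Free variables are named by
natural numbers, bound variables are de Bruijn indices: a proposition of `Form L n` may use `n`
dangling bound variables, and `all` binds the index `0`. Propositions proper are the elements of
`Form L 0`. -/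
inductive Form (L : FirstOrder.Language.{u, v}) : ℕ → Type (max u v)
  | rel {n k : ℕ} (P : L.Relations k) (ts : Fin k → L.Term (ℕ ⊕ Fin n)) : Form L n
  | imp {n : ℕ} (A B : Form L n) : Form L n
  | all {n : ℕ} (A : Form L (n + 1)) : Form L n

/-- The function symbols that occur in a term. -/
def termSymbols {L : FirstOrder.Language.{u, v}} {α : Type} : L.Term α → Set L.Symbols
  | .var _ => ∅
  | .func f ts => {Sum.inl ⟨_, f⟩} ∪ ⋃ i, termSymbols (ts i)

namespace Form

variable {L : FirstOrder.Language.{u, v}}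

/-- The function and predicate symbols that occur in a proposition. -/
def symbols : {n : ℕ} → Form L n → Set L.Symbols
  | _, rel P ts => {Sum.inr ⟨_, P⟩} ∪ ⋃ i, termSymbols (ts i)
  | _, imp A B => A.symbols ∪ B.symbols
  | _, all A => A.symbols

/-- The free variables of a proposition. -/
def freeVars : {n : ℕ} → Form L n → Set ℕ
  | _, rel _ ts => ⋃ i, ((ts i).varFinsetLeft : Set ℕ)
  | _, imp A B => A.freeVars ∪ B.freeVars
  | _, all A => A.freeVars

/-- Replacement of the outermost dangling bound variable, which has the largest index, by the
term `t`. If `all A` is a proposition `∀ x A`, then `A.inst t` is `(t/x)A`. -/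
def inst (t : L.Term ℕ) : {n : ℕ} → Form L (n + 1) → Form L n
  | _, rel P ts => rel P fun i => (ts i).subst
      (Sum.elim (fun x => .var (Sum.inl x))
        (Fin.lastCases (t.relabel Sum.inl) (fun j => .var (Sum.inr j))))
  | _, imp A B => imp (A.inst t) (B.inst t)
  | _, all A => all (A.inst t)

end Form

/-- `Provable Γ A`: the sequent `Γ ⊢ A` has a natural deduction proof in minimal predicate
logic. -/
inductive Provable {L : FirstOrder.Language.{u, v}} : List (Form L 0) → Form L 0 → Prop
  | ax {Γ : List (Form L 0)} {A : Form L 0} : A ∈ Γ → Provable Γ A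
  | impIntro {Γ : List (Form L 0)} {A B : Form L 0} :
      Provable (A :: Γ) B → Provable Γ (.imp A B)
  | impElim {Γ : List (Form L 0)} {A B : Form L 0} :
      Provable Γ (.imp A B) → Provable Γ A → Provable Γ B
  | allIntro {Γ : List (Form L 0)} {A : Form L 1} (x : ℕ) :
      (∀ C ∈ Γ, x ∉ C.freeVars) → x ∉ A.freeVars →
      Provable Γ (A.inst (.var x)) → Provable Γ (.all A)
  | allElim {Γ : List (Form L 0)} {A : Form L 1} (t : L.Term ℕ) :
      Provable Γ (.all A) → Provable Γ (A.inst t)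

end MinLogic

/-! ## The translation -/

namespace Translation

open LPi LPi.Min MinLogic

variable {L : FirstOrder.Language.{u, v}}

/-- Translation of a term under `n` binders; `ρ` gives the index, outside these binders, of the
λΠ variable that stands for a free variable or for a symbol of the language. -/
def term (ρ : ℕ ⊕ L.Symbols → ℕ) {n : ℕ} : L.Term (ℕ ⊕ Fin n) → Tm Cst
  | .var (Sum.inl x) => .var (n + ρ (Sum.inl x))
  | .var (Sum.inr i) => .var i
  | .func f ts =>
      Tm.apps (.var (n + ρ (Sum.inr (Sum.inl ⟨_, f⟩)))) (List.ofFn fun i => term ρ (ts i))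

/-- Translation of a proposition: `P(t₁, …, tₖ)` becomes `P t₁ … tₖ`, `A ⇒ B` becomes `⇒ A B`,
and `∀ z A` becomes `∀ ι (λ z : I, A)`. -/
def form (ρ : ℕ ⊕ L.Symbols → ℕ) : {n : ℕ} → Form L n → Tm Cst
  | n, .rel P ts =>
      Tm.apps (.var (n + ρ (Sum.inr (Sum.inr ⟨_, P⟩)))) (List.ofFn fun i => term ρ (ts i))
  | _, .imp A B => tImp (form ρ A) (form ρ B)
  | _, .all A => tAll tIota (.lam tI (form ρ A))

/-- `I → ⋯ → I → T` with `k` arguments. -/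
def arity (T : Tm Cst) : ℕ → Tm Cst
  | 0 => T
  | k + 1 => .arrow tI (arity T k)

/-- The type of the variable that stands for a symbol of the language. -/
def symbolType : L.Symbols → Tm Cst
  | Sum.inl f => arity tI f.1
  | Sum.inr P => arity tProp P.1

/-- The index of the variable that stands for a free variable or a symbol, in a context
`Γ, Δ, Δ'` where `Γ` declares the given symbols, `Δ` the given free variables, and `Δ'` has
length `k`. -/
noncomputable def index (Γ : List L.Symbols) (Δ : List ℕ) (k : ℕ) : ℕ ⊕ L.Symbols → ℕ
  | Sum.inl x => k + Δ.idxOf x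
  | Sum.inr s =>
      letI : DecidableEq L.Symbols := Classical.decEq L.Symbols
      k + Δ.length + Γ.idxOf s

/-- The λΠ context `Γ, Δ, Δ'`, where `Γ` declares each of the given symbols of the language with
its type, `Δ` declares each of the given variables with type `I`, and `Δ'` declares, for each
hypothesis `A`, a variable of type `Prf A`. -/
noncomputable def context (Γ : List L.Symbols) (Δ : List ℕ) : List (Form L 0) → Ctx Cst
  | [] => Δ.map (fun _ => tI) ++ Γ.map symbolType
  | A :: As => tPrf (form (index Γ Δ As.length) A) :: context Γ Δ As

/-- `Γ, Δ, Δ' ⊢ π : Prf B` in the theory `Σ_M, R_M`, where `Δ'` declares a proof variable for each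
element of `As`. -/
def IsProofTerm (Γ : List L.Symbols) (Δ : List ℕ) (As : List (Form L 0)) (B : Form L 0)
    (π : Tm Cst) : Prop :=
  Typing sig rules (context Γ Δ As) π (tPrf (form (index Γ Δ As.length) B))

end Translation

/-! ## Substitution algebra -/

namespace LPi

namespace Tm

variable {C : Type}

-- From logic to λΠ, a natural deduction proof becomes a term by induction on the derivation
-- (`exists_proofTerm`). A derivation may pass through variables and symbols that the context does
-- not declare, so propositions are translated along an environment that sends every name to a
-- well-typed term. In `exists_isProofTerm` declared names go to their λΠ variables, and the others
-- to default terms built from an inhabitant of `I`, whence the assumption of part 1, or from the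
-- translation of the conclusion.
--
-- From λΠ to logic, proof terms are not normalized. The theory is interpreted in a Kripke-style
-- model instead. A type denotes a set of raw terms together with a forcing relation on them, whose
-- worlds are lists of hypotheses ordered by inclusion. `I` denotes the terms convertible to codes
-- of first-order terms, `Set` the terms convertible to `ι`, and `Prf P` for an atom `P` contains
-- every term, forced at `w` when `P` is provable from all extensions of `w`. Quantifying over
-- extensions makes forcing monotone without a weakening lemma for derivations. Types depend on the
-- elements of other types but never on worlds, so membership is kept apart from forcing.
--
-- `Prop`, `TYPE` and `KIND` denote collections of terms that have an interpretation in a lower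
-- layer, so the interpretation is built in four layers: `BasePrf`, `BaseType`, `BaseKind`,
-- `BaseTop`. Convertible types have the same interpretation (`Interp.unique`) because reduction is
-- confluent (`church_rosser`), products are injective, and base types are normal.
--
-- In this model forcing `Prf A` amounts to provability of `A` (`interp_formIn_code`): adding a
-- hypothesis to the world yields `⇒`-introduction, and a fresh variable yields `∀`-introduction.
-- Typing is sound (`interp_of_typing`), so a proof term of `B`, with declared names replaced by
-- their codes, is forced at the world of its own hypotheses, and `B` is provable from them.

theorem upRen_comp (ξ ζ : ℕ → ℕ) (i : ℕ) : upRen ζ (upRen ξ i) = upRen (fun j => ζ (ξ j)) i := by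
  cases i <;> rfl

theorem rename_rename (t : Tm C) (ξ ζ : ℕ → ℕ) :
    (t.rename ξ).rename ζ = t.rename fun i => ζ (ξ i) := by
  induction t generalizing ξ ζ with
  | const c => rfl
  | var i => rfl
  | sort s => rfl
  | pi A B hA hB => simp only [rename, hA, hB, upRen_comp]
  | lam A t hA ht => simp only [rename, hA, ht, upRen_comp]
  | app t u ht hu => simp only [rename, ht, hu]

theorem up_upRen (ξ : ℕ → ℕ) (θ : ℕ → Tm C) (i : ℕ) :
    up θ (upRen ξ i) = up (fun j => θ (ξ j)) i := by
  cases i <;> rfl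

theorem subst_rename (t : Tm C) (ξ : ℕ → ℕ) (θ : ℕ → Tm C) :
    (t.rename ξ).subst θ = t.subst fun i => θ (ξ i) := by
  induction t generalizing ξ θ with
  | const c => rfl
  | var i => rfl
  | sort s => rfl
  | pi A B hA hB => simp only [rename, subst, hA, hB, up_upRen]
  | lam A t hA ht => simp only [rename, subst, hA, ht, up_upRen]
  | app t u ht hu => simp only [rename, subst, ht, hu]

theorem rename_up (ξ : ℕ → ℕ) (θ : ℕ → Tm C) (i : ℕ) :
    (up θ i).rename (upRen ξ) = up (fun j => (θ j).rename ξ) i := by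
  cases i with
  | zero => rfl
  | succ i => simp only [up, rename_rename, upRen]

theorem rename_subst (t : Tm C) (ξ : ℕ → ℕ) (θ : ℕ → Tm C) :
    (t.subst θ).rename ξ = t.subst fun i => (θ i).rename ξ := by
  induction t generalizing ξ θ with
  | const c => rfl
  | var i => rfl
  | sort s => rfl
  | pi A B hA hB => simp only [rename, subst, hA, hB, rename_up]
  | lam A t hA ht => simp only [rename, subst, hA, ht, rename_up]
  | app t u ht hu => simp only [rename, subst, ht, hu]

theorem subst_up (σ θ : ℕ → Tm C) (i : ℕ) :
    (up θ i).subst (up σ) = up (fun j => (θ j).subst σ) i := by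
  cases i with
  | zero => rfl
  | succ i => simp only [up, subst_rename, rename_subst]

theorem subst_subst (t : Tm C) (θ σ : ℕ → Tm C) :
    (t.subst θ).subst σ = t.subst fun i => (θ i).subst σ := by
  induction t generalizing θ σ with
  | const c => rfl
  | var i => rfl
  | sort s => rfl
  | pi A B hA hB => simp only [subst, hA, hB, subst_up]
  | lam A t hA ht => simp only [subst, hA, ht, subst_up]
  | app t u ht hu => simp only [subst, ht, hu]

theorem up_var : up (var : ℕ → Tm C) = var := by
  funext i; cases i <;> rfl

@[simp]
theorem subst_var (t : Tm C) : t.subst var = t := by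
  induction t with
  | const c => rfl
  | var i => rfl
  | sort s => rfl
  | pi A B hA hB => simp only [subst, up_var, hA, hB]
  | lam A t hA ht => simp only [subst, up_var, hA, ht]
  | app t u ht hu => simp only [subst, ht, hu]

theorem up_var_comp (ξ : ℕ → ℕ) : up (fun i => (var (ξ i) : Tm C)) = fun i => var (upRen ξ i) := by
  funext i; cases i <;> rfl

theorem rename_eq_subst (t : Tm C) (ξ : ℕ → ℕ) : t.rename ξ = t.subst fun i => var (ξ i) := by
  conv_lhs => rw [← subst_var t, rename_subst]
  rfl

/-- The substitution that maps the index `0` to `u` and the index `i + 1` to `θ i`. -/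
def scons (u : Tm C) (θ : ℕ → Tm C) : ℕ → Tm C
  | 0 => u
  | i + 1 => θ i

theorem inst_eq (t u : Tm C) : t.inst u = t.subst (scons u var) := by
  unfold inst
  congr 1

theorem subst_up_inst (t u : Tm C) (θ : ℕ → Tm C) :
    (t.subst (up θ)).inst u = t.subst (scons u θ) := by
  rw [inst_eq, subst_subst]
  congr 1
  funext i
  cases i with
  | zero => rfl
  | succ i => simp only [up, subst_rename, scons, subst_var]

theorem inst_subst (t u : Tm C) (θ : ℕ → Tm C) :
    (t.inst u).subst θ = (t.subst (up θ)).inst (u.subst θ) := by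
  rw [subst_up_inst, inst_eq, subst_subst]
  congr 1
  funext i
  cases i <;> rfl

theorem inst_rename (t u : Tm C) (ξ : ℕ → ℕ) :
    (t.inst u).rename ξ = (t.rename (upRen ξ)).inst (u.rename ξ) := by
  rw [rename_eq_subst, inst_subst, rename_eq_subst u, rename_eq_subst t, up_var_comp]

@[simp]
theorem rename_succ_inst (t u : Tm C) : (t.rename Nat.succ).inst u = t := by
  rw [inst_eq, subst_rename]
  exact subst_var t

@[simp]
theorem rename_upRen_succ_inst (t : Tm C) : (t.rename (upRen Nat.succ)).inst (var 0) = t := by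
  rw [inst_eq, subst_rename]
  convert subst_var t using 2
  funext i
  cases i <;> rfl

theorem rename_succ_subst_up (t : Tm C) (θ : ℕ → Tm C) :
    (t.rename Nat.succ).subst (up θ) = (t.subst θ).rename Nat.succ := by
  rw [subst_rename, rename_subst]
  rfl

theorem rename_succ_rename (t : Tm C) (ξ : ℕ → ℕ) :
    (t.rename Nat.succ).rename (upRen ξ) = (t.rename ξ).rename Nat.succ := by
  rw [rename_rename, rename_rename]
  rfl

theorem subst_arrow (A B : Tm C) (θ : ℕ → Tm C) :
    (arrow A B).subst θ = arrow (A.subst θ) (B.subst θ) := by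
  simp only [arrow, subst, rename_succ_subst_up]

theorem rename_arrow (A B : Tm C) (ξ : ℕ → ℕ) :
    (arrow A B).rename ξ = arrow (A.rename ξ) (B.rename ξ) := by
  simp only [arrow, rename, rename_succ_rename]

end Tm

/-! ## Conversion -/

section Conversion

variable {C : Type} {R : Set (Tm C × Tm C)}

theorem Step.subst {t u : Tm C} (h : Step R t u) (θ : ℕ → Tm C) :
    Step R (t.subst θ) (u.subst θ) := by
  induction h generalizing θ with
  | beta A t u =>
    rw [Tm.inst_subst]
    exact .beta _ _ _
  | rule l r σ h =>
    rw [Tm.subst_subst, Tm.subst_subst]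
    exact .rule _ _ _ h
  | piLeft B _ ih => exact .piLeft _ (ih θ)
  | piRight A _ ih => exact .piRight _ (ih _)
  | lamLeft B _ ih => exact .lamLeft _ (ih θ)
  | lamRight A _ ih => exact .lamRight _ (ih _)
  | appLeft u _ ih => exact .appLeft _ (ih θ)
  | appRight t _ ih => exact .appRight _ (ih θ)

namespace Conv

theorem refl (t : Tm C) : Conv R t t := Relation.EqvGen.refl t

theorem symm {t u : Tm C} (h : Conv R t u) : Conv R u t := Relation.EqvGen.symm _ _ h

theorem trans {t u v : Tm C} (h : Conv R t u) (h' : Conv R u v) : Conv R t v :=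
  Relation.EqvGen.trans _ _ _ h h'

theorem of_step {t u : Tm C} (h : Step R t u) : Conv R t u := Relation.EqvGen.rel _ _ h

theorem map {f : Tm C → Tm C} (hf : ∀ t u, Step R t u → Step R (f t) (f u)) {t u : Tm C}
    (h : Conv R t u) : Conv R (f t) (f u) := by
  induction h with
  | rel t u h => exact of_step (hf _ _ h)
  | refl t => exact refl _
  | symm t u _ ih => exact ih.symm
  | trans t u v _ _ ih ih' => exact ih.trans ih'

theorem subst {t u : Tm C} (h : Conv R t u) (θ : ℕ → Tm C) : Conv R (t.subst θ) (u.subst θ) :=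
  h.map fun _ _ h => h.subst θ

theorem rename {t u : Tm C} (h : Conv R t u) (ξ : ℕ → ℕ) : Conv R (t.rename ξ) (u.rename ξ) := by
  rw [Tm.rename_eq_subst, Tm.rename_eq_subst]
  exact h.subst _

theorem inst {t u : Tm C} (h : Conv R t u) (d : Tm C) : Conv R (t.inst d) (u.inst d) :=
  h.subst _

theorem pi {A A' B B' : Tm C} (hA : Conv R A A') (hB : Conv R B B') :
    Conv R (.pi A B) (.pi A' B') :=
  (hA.map (f := fun A => .pi A B) fun _ _ h => .piLeft _ h).trans
    (hB.map (f := fun B => .pi A' B) fun _ _ h => .piRight _ h)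

theorem lam {A A' t t' : Tm C} (hA : Conv R A A') (ht : Conv R t t') :
    Conv R (.lam A t) (.lam A' t') :=
  (hA.map (f := fun A => .lam A t) fun _ _ h => .lamLeft _ h).trans
    (ht.map (f := fun t => .lam A' t) fun _ _ h => .lamRight _ h)

theorem app {t t' u u' : Tm C} (ht : Conv R t t') (hu : Conv R u u') :
    Conv R (.app t u) (.app t' u') :=
  (ht.map (f := fun t => .app t u) fun _ _ h => .appLeft _ h).trans
    (hu.map (f := fun u => .app t' u) fun _ _ h => .appRight _ h)

theorem beta (A t u : Tm C) : Conv R (.app (.lam A t) u) (t.inst u) := of_step (.beta A t u)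

end Conv

end Conversion

/-! ## Confluence -/

namespace Min

open Tm

theorem step_El : Step rules (tEl tIota) tI :=
  .rule (tEl tIota) tI Tm.var (Or.inl rfl)

theorem step_imp (x y : Tm Cst) :
    Step rules (tPrf (tImp x y)) (.arrow (tPrf x) (tPrf y)) := by
  have h := Step.rule (R := rules) _ _ (scons x (scons y Tm.var)) (Or.inr (Or.inl rfl))
  rw [subst_arrow] at h
  exact h

theorem step_all (x p : Tm Cst) :
    Step rules (tPrf (tAll x p))
      (.pi (tEl x) (tPrf (.app (p.rename Nat.succ) (.var 0)))) :=
  Step.rule (R := rules) _ _ (scons x (scons p Tm.var)) (Or.inr (Or.inr rfl))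

/-- Parallel reduction. -/
inductive Par : Tm Cst → Tm Cst → Prop
  | const (c : Cst) : Par (.const c) (.const c)
  | var (i : ℕ) : Par (.var i) (.var i)
  | sort (s : Srt) : Par (.sort s) (.sort s)
  | pi {A A' B B' : Tm Cst} : Par A A' → Par B B' → Par (.pi A B) (.pi A' B')
  | lam {A A' t t' : Tm Cst} : Par A A' → Par t t' → Par (.lam A t) (.lam A' t')
  | app {t t' u u' : Tm Cst} : Par t t' → Par u u' → Par (.app t u) (.app t' u')
  | beta (A : Tm Cst) {t t' u u' : Tm Cst} :
      Par t t' → Par u u' → Par (.app (.lam A t) u) (t'.inst u')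
  | El : Par (.app (.const .El) (.const .iota)) (.const .I)
  | imp {x x' y y' : Tm Cst} : Par x x' → Par y y' →
      Par (.app (.const .Prf) (.app (.app (.const .imp) x) y)) (.arrow (tPrf x') (tPrf y'))
  | all {x x' p p' : Tm Cst} : Par x x' → Par p p' →
      Par (.app (.const .Prf) (.app (.app (.const .all) x) p))
        (.pi (tEl x') (tPrf (.app (p'.rename Nat.succ) (.var 0))))

namespace Par

theorem refl (t : Tm Cst) : Par t t := by
  induction t with
  | const c => exact .const c
  | var i => exact .var i
  | sort s => exact .sort s
  | pi A B hA hB => exact .pi hA hB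
  | lam A t hA ht => exact .lam hA ht
  | app t u ht hu => exact .app ht hu

theorem of_step {t u : Tm Cst} (h : Step rules t u) : Par t u := by
  induction h with
  | beta A t u => exact .beta A (refl t) (refl u)
  | rule l r θ h =>
    rcases h with h | h | h
    · cases h; exact .El
    · cases h
      rw [subst_arrow]
      exact .imp (refl _) (refl _)
    · cases h
      exact .all (refl _) (refl _)
  | piLeft B _ ih => exact .pi ih (refl _)
  | piRight A _ ih => exact .pi (refl _) ih
  | lamLeft B _ ih => exact .lam ih (refl _)
  | lamRight A _ ih => exact .lam (refl _) ih
  | appLeft u _ ih => exact .app ih (refl _)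
  | appRight t _ ih => exact .app (refl _) ih

theorem conv {t u : Tm Cst} (h : Par t u) : Conv rules t u := by
  induction h with
  | const c => exact .refl _
  | var i => exact .refl _
  | sort s => exact .refl _
  | pi _ _ hA hB => exact .pi hA hB
  | lam _ _ hA ht => exact .lam hA ht
  | app _ _ ht hu => exact .app ht hu
  | beta A _ _ ht hu => exact (Conv.app (.lam (.refl A) ht) hu).trans (.beta _ _ _)
  | El => exact .of_step step_El
  | imp _ _ hx hy =>
    exact (Conv.app (.refl _) (.app (.app (.refl _) hx) hy)).trans (.of_step (step_imp _ _))
  | all _ _ hx hp =>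
    exact (Conv.app (.refl _) (.app (.app (.refl _) hx) hp)).trans (.of_step (step_all _ _))

theorem rename {t u : Tm Cst} (h : Par t u) (ξ : ℕ → ℕ) : Par (t.rename ξ) (u.rename ξ) := by
  induction h generalizing ξ with
  | const c => exact .const c
  | var i => exact .var _
  | sort s => exact .sort s
  | pi _ _ hA hB => exact .pi (hA _) (hB _)
  | lam _ _ hA ht => exact .lam (hA _) (ht _)
  | app _ _ ht hu => exact .app (ht _) (hu _)
  | beta A _ _ ht hu =>
    rw [inst_rename]
    exact .beta _ (ht _) (hu _)
  | El => exact .El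
  | imp _ _ hx hy =>
    rw [rename_arrow]
    exact .imp (hx _) (hy _)
  | all _ _ hx hp =>
    simp only [tPrf, tEl, Tm.rename, rename_succ_rename]
    exact .all (hx _) (hp _)

theorem up {θ σ : ℕ → Tm Cst} (h : ∀ i, Par (θ i) (σ i)) (i : ℕ) : Par (up θ i) (up σ i) := by
  cases i with
  | zero => exact .var 0
  | succ i => exact (h i).rename _

theorem subst {t u : Tm Cst} (h : Par t u) {θ σ : ℕ → Tm Cst} (hθ : ∀ i, Par (θ i) (σ i)) :
    Par (t.subst θ) (u.subst σ) := by
  induction h generalizing θ σ with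
  | const c => exact .const c
  | var i => exact hθ i
  | sort s => exact .sort s
  | pi _ _ hA hB => exact .pi (hA hθ) (hB (up hθ))
  | lam _ _ hA ht => exact .lam (hA hθ) (ht (up hθ))
  | app _ _ ht hu => exact .app (ht hθ) (hu hθ)
  | beta A _ _ ht hu =>
    rw [inst_subst]
    exact .beta _ (ht (up hθ)) (hu hθ)
  | El => exact .El
  | imp _ _ hx hy =>
    rw [subst_arrow]
    exact .imp (hx hθ) (hy hθ)
  | all _ _ hx hp =>
    simp only [tPrf, tEl, Tm.subst, rename_succ_subst_up]
    exact .all (hx hθ) (hp hθ)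

theorem inst {t t' u u' : Tm Cst} (ht : Par t t') (hu : Par u u') :
    Par (t.inst u) (t'.inst u') := by
  rw [inst_eq, inst_eq]
  refine ht.subst fun i => ?_
  cases i with
  | zero => exact hu
  | succ i => exact .var i

theorem const_inv {c : Cst} {s : Tm Cst} (h : Par (.const c) s) : s = .const c := by
  cases h; rfl

theorem lam_inv {A t s : Tm Cst} (h : Par (.lam A t) s) :
    ∃ A' t', s = .lam A' t' ∧ Par A A' ∧ Par t t' := by
  cases h with
  | lam hA ht => exact ⟨_, _, rfl, hA, ht⟩

theorem pi_inv {A B s : Tm Cst} (h : Par (.pi A B) s) :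
    ∃ A' B', s = .pi A' B' ∧ Par A A' ∧ Par B B' := by
  cases h with
  | pi hA ht => exact ⟨_, _, rfl, hA, ht⟩

/-- Inversion for the application of a constant other than `El` and `Prf` to two arguments. -/
theorem const_app_app_inv {c : Cst} (hE : c ≠ .El) (hP : c ≠ .Prf) {x y s : Tm Cst}
    (h : Par (.app (.app (.const c) x) y) s) :
    ∃ x' y', s = .app (.app (.const c) x') y' ∧ Par x x' ∧ Par y y' := by
  cases h with
  | app h hy =>
    cases h with
    | app hc hx => cases hc; exact ⟨_, _, rfl, hx, hy⟩
    | El => exact absurd rfl hE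
    | imp => exact absurd rfl hP
    | all => exact absurd rfl hP

/-- Every term has a complete development. -/
theorem exists_triangle (t : Tm Cst) : ∃ t', ∀ s, Par t s → Par s t' := by
  induction t with
  | const c => exact ⟨_, fun s h => by cases h; exact .const c⟩
  | var i => exact ⟨_, fun s h => by cases h; exact .var i⟩
  | sort i => exact ⟨_, fun s h => by cases h; exact .sort i⟩
  | pi A B hA hB =>
    obtain ⟨A', hA⟩ := hA
    obtain ⟨B', hB⟩ := hB
    exact ⟨.pi A' B', fun s h => by cases h with | pi h h' => exact .pi (hA _ h) (hB _ h')⟩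
  | lam A B hA hB =>
    obtain ⟨A', hA⟩ := hA
    obtain ⟨B', hB⟩ := hB
    exact ⟨.lam A' B', fun s h => by cases h with | lam h h' => exact .lam (hA _ h) (hB _ h')⟩
  | app t u ht hu =>
    obtain ⟨t', ht⟩ := ht
    obtain ⟨u', hu⟩ := hu
    -- The complete development contracts the redex at the root, if any. The left-hand sides of β
    -- and of the three rules do not overlap, so at most one applies.
    by_cases h₁ : ∃ A b, t = .lam A b
    · obtain ⟨A, b, rfl⟩ := h₁
      obtain ⟨A', b', rfl, -, -⟩ := (ht _ (refl _)).lam_inv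
      -- The induction hypothesis speaks of the whole abstraction; applied to reducts of its body
      -- alone, it yields the triangle property for `b`.
      have hb : ∀ s, Par b s → Par s b' := fun s h => by
        cases ht _ (.lam (refl A) h) with | lam _ h => exact h
      refine ⟨b'.inst u', fun s h => ?_⟩
      cases h with
      | app h h' =>
        cases h with | lam _ h => exact .beta _ (hb _ h) (hu _ h')
      | beta _ h h' => exact (hb _ h).inst (hu _ h')
    by_cases h₂ : t = .const .El ∧ u = .const .iota
    · obtain ⟨rfl, rfl⟩ := h₂
      refine ⟨.const .I, fun s h => ?_⟩
      cases h with
      | app h h' => cases h; cases h'; exact .El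
      | El => exact .const _
    by_cases h₃ : t = .const .Prf ∧ ∃ x y, u = tImp x y
    · obtain ⟨rfl, x, y, rfl⟩ := h₃
      obtain ⟨x', y', rfl, -, -⟩ := (hu _ (refl _)).const_app_app_inv (by simp) (by simp)
      -- As for β, the triangle property of the whole argument is split into those of `x` and `y`.
      have hxy : ∀ a b, Par x a → Par y b → Par a x' ∧ Par b y' := fun a b ha hb => by
        obtain ⟨_, _, h, h₁, h₂⟩ := (hu _ (.app (.app (.const _) ha) hb)).const_app_app_inv
          (by simp) (by simp)
        simp only [app.injEq, true_and] at h
        exact ⟨h.1 ▸ h₁, h.2 ▸ h₂⟩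
      refine ⟨.arrow (tPrf x') (tPrf y'), fun s h => ?_⟩
      cases h with
      | app h h' =>
        cases h
        obtain ⟨a, b, rfl, ha, hb⟩ := h'.const_app_app_inv (by simp) (by simp)
        exact .imp (hxy _ _ ha hb).1 (hxy _ _ ha hb).2
      | imp ha hb =>
        exact .pi (.app (.const _) (hxy _ _ ha hb).1)
          (Par.rename (.app (.const _) (hxy _ _ ha hb).2) _)
    by_cases h₄ : t = .const .Prf ∧ ∃ x y, u = tAll x y
    · obtain ⟨rfl, x, y, rfl⟩ := h₄
      obtain ⟨x', y', rfl, -, -⟩ := (hu _ (refl _)).const_app_app_inv (by simp) (by simp)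
      have hxy : ∀ a b, Par x a → Par y b → Par a x' ∧ Par b y' := fun a b ha hb => by
        obtain ⟨_, _, h, h₁, h₂⟩ := (hu _ (.app (.app (.const _) ha) hb)).const_app_app_inv
          (by simp) (by simp)
        simp only [app.injEq, true_and] at h
        exact ⟨h.1 ▸ h₁, h.2 ▸ h₂⟩
      refine ⟨.pi (tEl x') (tPrf (.app (y'.rename Nat.succ) (.var 0))), fun s h => ?_⟩
      cases h with
      | app h h' =>
        cases h
        obtain ⟨a, b, rfl, ha, hb⟩ := h'.const_app_app_inv (by simp) (by simp)
        exact .all (hxy _ _ ha hb).1 (hxy _ _ ha hb).2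
      | all ha hb =>
        exact .pi (.app (.const _) (hxy _ _ ha hb).1)
          (.app (.const _) (.app ((hxy _ _ ha hb).2.rename _) (.var 0)))
    refine ⟨.app t' u', fun s h => ?_⟩
    cases h with
    | app h h' => exact .app (ht _ h) (hu _ h')
    | beta => exact absurd ⟨_, _, rfl⟩ h₁
    | El => exact absurd ⟨rfl, rfl⟩ h₂
    | imp => exact absurd ⟨rfl, _, _, rfl⟩ h₃
    | all => exact absurd ⟨rfl, _, _, rfl⟩ h₄

end Par

/-- The reflexive and transitive closure of parallel reduction. -/
abbrev Red : Tm Cst → Tm Cst → Prop := Relation.ReflTransGen Par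

theorem Red.conv {t u : Tm Cst} (h : Red t u) : Conv rules t u := by
  induction h with
  | refl => exact .refl _
  | tail _ h ih => exact ih.trans h.conv

/-- Two parallel reducts of a term both reduce to its complete development. This diamond property
makes joinability an equivalence relation, which contains `Step` and hence `Conv`. -/
theorem church_rosser {t u : Tm Cst} (h : Conv rules t u) : ∃ v, Red t v ∧ Red u v := by
  have equiv : Equivalence (Relation.Join Red) :=
    Relation.equivalence_join_reflTransGen fun a b c hb hc => by
      obtain ⟨d, hd⟩ := Par.exists_triangle a
      exact ⟨d, .single (hd _ hb), .single (hd _ hc)⟩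
  induction h with
  | rel t u h => exact ⟨u, .single (Par.of_step h), .refl⟩
  | refl t => exact ⟨t, .refl, .refl⟩
  | symm t u _ ih => exact equiv.symm ih
  | trans t u v _ _ ih ih' => exact equiv.trans ih ih'

-- Consequences of confluence: products and normal forms

theorem Red.pi_inv {A B s : Tm Cst} (h : Red (.pi A B) s) :
    ∃ A' B', s = .pi A' B' ∧ Red A A' ∧ Red B B' := by
  induction h with
  | refl => exact ⟨A, B, rfl, .refl, .refl⟩
  | tail _ h ih =>
    obtain ⟨A', B', rfl, hA, hB⟩ := ih
    obtain ⟨A'', B'', rfl, hA', hB'⟩ := h.pi_inv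
    exact ⟨A'', B'', rfl, hA.tail hA', hB.tail hB'⟩

/-- No rule acts at the root of a product, so a common reduct of two products is a product of common
reducts. -/
theorem conv_pi_inj {A A' B B' : Tm Cst} (h : Conv rules (.pi A B) (.pi A' B')) :
    Conv rules A A' ∧ Conv rules B B' := by
  obtain ⟨v, h, h'⟩ := church_rosser h
  obtain ⟨A₁, B₁, rfl, hA, hB⟩ := h.pi_inv
  obtain ⟨A₂, B₂, h, hA', hB'⟩ := h'.pi_inv
  cases h
  exact ⟨hA.conv.trans hA'.conv.symm, hB.conv.trans hB'.conv.symm⟩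

/-- Terms that are irreducible for parallel reduction. -/
def Normal (t : Tm Cst) : Prop := ∀ s, Par t s → s = t

theorem Normal.red {t s : Tm Cst} (ht : Normal t) (h : Red t s) : s = t := by
  induction h with
  | refl => rfl
  | tail _ h ih => subst ih; exact ht _ h

theorem Normal.eq_of_conv {t u : Tm Cst} (ht : Normal t) (hu : Normal u)
    (h : Conv rules t u) : t = u := by
  obtain ⟨v, h, h'⟩ := church_rosser h
  rw [← ht.red h, hu.red h']

theorem Normal.not_conv_pi {t : Tm Cst} (ht : Normal t) (h : ∀ A B, t ≠ .pi A B) (A B : Tm Cst) :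
    ¬ Conv rules t (.pi A B) := fun hc => by
  obtain ⟨v, h₁, h₂⟩ := church_rosser hc
  obtain ⟨A', B', rfl, -, -⟩ := h₂.pi_inv
  exact h _ _ (ht.red h₁).symm

theorem normal_const (c : Cst) : Normal (.const c) := fun _ h => h.const_inv

theorem normal_sort (s : Srt) : Normal (.sort s) := fun _ h => by cases h; rfl

/-- Terms built from variables by application. -/
inductive Algebraic : Tm Cst → Prop
  | var (i : ℕ) : Algebraic (.var i)
  | app {t u : Tm Cst} : Algebraic t → Algebraic u → Algebraic (.app t u)

theorem Algebraic.normal {t : Tm Cst} (h : Algebraic t) : Normal t := by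
  induction h with
  | var i => intro s h; cases h; rfl
  | app ht _ iht ihu =>
    intro s h
    cases h with
    | app h h' => rw [iht _ h, ihu _ h']
    | _ => cases ht

/-- The head of `t` is a variable, neither `⇒` nor `∀`, so no rule for `Prf` applies. This lets `Prf
P` with `P` atomic serve as a base type. -/
theorem Algebraic.normal_prf {t : Tm Cst} (ht : Algebraic t) : Normal (tPrf t) := by
  intro s h
  cases h with
  | app h h' => rw [h.const_inv, ht.normal _ h']; rfl
  | imp => cases ht with | app h _ => cases h with | app h _ => cases h
  | all => cases ht with | app h _ => cases h with | app h _ => cases h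

end Min

end LPi

/-! ## Translation along an environment -/

namespace LPi.Tm

variable {C : Type}

theorem apps_subst (us : List (Tm C)) (t : Tm C) (θ : ℕ → Tm C) :
    (apps t us).subst θ = apps (t.subst θ) (us.map (subst θ)) := by
  induction us generalizing t with
  | nil => rfl
  | cons u us ih => exact ih (.app t u)

/-- The substitution `θ` pushed under `n` binders. -/
def upN : ℕ → (ℕ → Tm C) → ℕ → Tm C
  | 0, θ => θ
  | n + 1, θ => up (upN n θ)

theorem upN_lt (n : ℕ) (θ : ℕ → Tm C) (i : ℕ) (h : i < n) : upN n θ i = var i := by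
  induction n generalizing i with
  | zero => omega
  | succ n ih =>
    cases i with
    | zero => rfl
    | succ i => simp only [upN, up, ih i (by omega), rename, Nat.succ_eq_add_one]

theorem upN_add (n : ℕ) (θ : ℕ → Tm C) (i : ℕ) : upN n θ (i + n) = (θ i).rename (· + n) := by
  induction n with
  | zero => exact ((rename_eq_subst _ _).trans (subst_var _)).symm
  | succ n ih =>
    simp only [upN]
    rw [← Nat.add_assoc]
    simp only [up, ih, rename_rename]
    rfl

theorem rename_add_subst_upN (n : ℕ) (θ : ℕ → Tm C) (t : Tm C) :
    (t.rename (· + n)).subst (upN n θ) = (t.subst θ).rename (· + n) := by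
  rw [subst_rename, rename_subst]
  congr 1
  funext i
  exact upN_add n θ i

end LPi.Tm

-- Sizes, symbols and free variables of propositions

namespace MinLogic

variable {L : FirstOrder.Language.{u, v}}

theorem Form.finite_freeVars {n : ℕ} (A : Form L n) : A.freeVars.Finite := by
  induction A with
  | rel P ts => exact Set.finite_iUnion fun i => Finset.finite_toSet _
  | imp A B hA hB => exact hA.union hB
  | all A hA => exact hA

/-- The number of connectives of a proposition. -/
def Form.size : {n : ℕ} → Form L n → ℕ
  | _, .rel _ _ => 0
  | _, .imp A B => A.size + B.size + 1
  | _, .all A => A.size + 1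

/-- An instance of `A` is not a subformula of `∀ x A`; it is however smaller, which is what the
induction in `interp_formIn_code` uses. -/
theorem Form.size_inst (t : L.Term ℕ) : {n : ℕ} → (A : Form L (n + 1)) → (A.inst t).size = A.size
  | _, .rel _ _ => by simp only [inst, size]
  | _, .imp A B => by simp only [inst, size, size_inst t A, size_inst t B]
  | _, .all A => by simp only [inst, size, size_inst t A]

theorem termSymbols_subst {α β : Type} (S : Set L.Symbols) (t : L.Term α) (σ : α → L.Term β)
    (ht : termSymbols t ⊆ S) (hσ : ∀ a, termSymbols (σ a) ⊆ S) : termSymbols (t.subst σ) ⊆ S := by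
  induction t with
  | var a => exact hσ a
  | func f ts ih =>
    simp only [termSymbols, Set.union_subset_iff, Set.iUnion_subset_iff] at ht
    simp only [FirstOrder.Language.Term.subst, termSymbols, Set.union_subset_iff,
      Set.iUnion_subset_iff]
    exact ⟨ht.1, fun i => ih i (ht.2 i)⟩

theorem termSymbols_relabel {α β : Type} (t : L.Term α) (g : α → β) :
    termSymbols (t.relabel g) = termSymbols t := by
  induction t with
  | var a => rfl
  | func f ts ih => simp only [FirstOrder.Language.Term.relabel, termSymbols, ih]

theorem Form.symbols_inst {S : Set L.Symbols} {t : L.Term ℕ} (ht : termSymbols t ⊆ S) :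
    {n : ℕ} → (A : Form L (n + 1)) → A.symbols ⊆ S → (A.inst t).symbols ⊆ S
  | _, .rel P ts, hA => by
    simp only [symbols, Set.union_subset_iff, Set.iUnion_subset_iff] at hA
    simp only [inst, symbols, Set.union_subset_iff, Set.iUnion_subset_iff]
    refine ⟨hA.1, fun i => termSymbols_subst S _ _ (hA.2 i) ?_⟩
    rintro (x | j)
    · exact Set.empty_subset _
    · refine Fin.lastCases ?_ (fun j => ?_) j
      · simpa only [Sum.elim_inr, Fin.lastCases_last, termSymbols_relabel] using ht
      · simp only [Sum.elim_inr, Fin.lastCases_castSucc]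
        exact Set.empty_subset _
  | _, .imp A B, hA => by
    simp only [symbols, Set.union_subset_iff] at hA
    simp only [inst, symbols, Set.union_subset_iff]
    exact ⟨symbols_inst ht A hA.1, symbols_inst ht B hA.2⟩
  | _, .all A, hA => by
    simp only [symbols] at hA
    simp only [inst, symbols]
    exact symbols_inst ht A hA

end MinLogic

namespace Translation

open LPi LPi.Min MinLogic

variable {L : FirstOrder.Language.{u, v}}

/-- Translation of a term under `n` binders; `M` gives the λΠ term, outside these binders, that
stands for a free variable or for a symbol of the language. -/
def termIn (M : ℕ ⊕ L.Symbols → Tm Cst) {n : ℕ} : L.Term (ℕ ⊕ Fin n) → Tm Cst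
  | .var (Sum.inl x) => (M (Sum.inl x)).rename (· + n)
  | .var (Sum.inr i) => .var i
  | .func f ts =>
      Tm.apps ((M (Sum.inr (Sum.inl ⟨_, f⟩))).rename (· + n))
        (List.ofFn fun i => termIn M (ts i))

/-- Translation of a proposition along the environment `M`. -/
def formIn (M : ℕ ⊕ L.Symbols → Tm Cst) : {n : ℕ} → Form L n → Tm Cst
  | n, .rel P ts =>
      Tm.apps ((M (Sum.inr (Sum.inr ⟨_, P⟩))).rename (· + n))
        (List.ofFn fun i => termIn M (ts i))
  | _, .imp A B => tImp (formIn M A) (formIn M B)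
  | _, .all A => tAll tIota (.lam tI (formIn M A))

theorem term_eq_termIn (ρ : ℕ ⊕ L.Symbols → ℕ) {n : ℕ} (t : L.Term (ℕ ⊕ Fin n)) :
    term ρ t = termIn (fun k => .var (ρ k)) t := by
  induction t with
  | var k => rcases k with x | i <;> simp only [term, termIn, Tm.rename, Nat.add_comm]
  | func f ts ih => simp only [term, termIn, Tm.rename, Nat.add_comm, ih]

theorem form_eq_formIn (ρ : ℕ ⊕ L.Symbols → ℕ) {n : ℕ} (A : Form L n) :
    form ρ A = formIn (fun k => .var (ρ k)) A := by
  induction A with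
  | rel P ts => simp only [form, formIn, Tm.rename, Nat.add_comm, term_eq_termIn]
  | imp A B hA hB => simp only [form, formIn, hA, hB]
  | all A hA => simp only [form, formIn, hA]

theorem termIn_subst (M : ℕ ⊕ L.Symbols → Tm Cst) (θ : ℕ → Tm Cst) {n : ℕ}
    (t : L.Term (ℕ ⊕ Fin n)) :
    (termIn M t).subst (Tm.upN n θ) = termIn (fun k => (M k).subst θ) t := by
  induction t with
  | var k =>
    rcases k with x | i
    · simp only [termIn, Tm.rename_add_subst_upN]
    · simp only [termIn, Tm.subst, Tm.upN_lt _ _ _ i.2]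
  | func f ts ih =>
    simp only [termIn, Tm.apps_subst, Tm.rename_add_subst_upN, List.map_ofFn,
      Function.comp_def, ih]

theorem formIn_subst_upN (M : ℕ ⊕ L.Symbols → Tm Cst) (θ : ℕ → Tm Cst) {n : ℕ}
    (A : Form L n) :
    (formIn M A).subst (Tm.upN n θ) = formIn (fun k => (M k).subst θ) A := by
  induction A with
  | rel P ts =>
    simp only [formIn, Tm.apps_subst, Tm.rename_add_subst_upN, List.map_ofFn,
      Function.comp_def, termIn_subst]
  | imp A B hA hB => simp only [formIn, tImp, Tm.subst, hA, hB]
  | all A hA => simp only [formIn, tAll, tIota, tI, Tm.subst, ← hA, Tm.upN]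

/-- Environments take terms as values so that substitution only changes the environment. Weakening
and the closing substitution of the model are both instances. -/
theorem formIn_subst (M : ℕ ⊕ L.Symbols → Tm Cst) (θ : ℕ → Tm Cst) (A : Form L 0) :
    (formIn M A).subst θ = formIn (fun k => (M k).subst θ) A :=
  formIn_subst_upN M θ A

theorem formIn_rename (M : ℕ ⊕ L.Symbols → Tm Cst) (ξ : ℕ → ℕ) (A : Form L 0) :
    (formIn M A).rename ξ = formIn (fun k => (M k).rename ξ) A := by
  simp only [Tm.rename_eq_subst, formIn_subst]

/-- The symbols and free variables that occur in a term. -/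
def termOccs {n : ℕ} (t : L.Term (ℕ ⊕ Fin n)) : Set (ℕ ⊕ L.Symbols) :=
  Sum.inl '' (t.varFinsetLeft : Set ℕ) ∪ Sum.inr '' termSymbols t

/-- The symbols and free variables that occur in a proposition. -/
def occs {n : ℕ} (A : Form L n) : Set (ℕ ⊕ L.Symbols) :=
  Sum.inl '' A.freeVars ∪ Sum.inr '' A.symbols

theorem termOccs_func_subset {n k : ℕ} (f : L.Functions k) (ts : Fin k → L.Term (ℕ ⊕ Fin n))
    (i : Fin k) : termOccs (ts i) ⊆ termOccs (.func f ts) := by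
  rintro k (⟨x, hx, rfl⟩ | ⟨s, hs, rfl⟩)
  · refine Or.inl ⟨x, ?_, rfl⟩
    simp only [FirstOrder.Language.Term.varFinsetLeft, Finset.coe_biUnion, Set.mem_iUnion]
    exact ⟨i, by simp, hx⟩
  · exact Or.inr ⟨s, Or.inr (Set.mem_iUnion.2 ⟨i, hs⟩), rfl⟩

theorem termOccs_rel_subset {n k : ℕ} (P : L.Relations k) (ts : Fin k → L.Term (ℕ ⊕ Fin n))
    (i : Fin k) : termOccs (ts i) ⊆ occs (.rel P ts) := by
  rintro k (⟨x, hx, rfl⟩ | ⟨s, hs, rfl⟩)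
  · exact Or.inl ⟨x, Set.mem_iUnion.2 ⟨i, hx⟩, rfl⟩
  · exact Or.inr ⟨s, Or.inr (Set.mem_iUnion.2 ⟨i, hs⟩), rfl⟩

theorem occs_imp_left {n : ℕ} (A B : Form L n) : occs A ⊆ occs (.imp A B) :=
  Set.union_subset_union (Set.image_mono Set.subset_union_left)
    (Set.image_mono Set.subset_union_left)

theorem occs_imp_right {n : ℕ} (A B : Form L n) : occs B ⊆ occs (.imp A B) :=
  Set.union_subset_union (Set.image_mono Set.subset_union_right)
    (Set.image_mono Set.subset_union_right)

theorem mem_termOccs_var {n : ℕ} (x : ℕ) :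
    Sum.inl x ∈ termOccs (.var (Sum.inl x) : L.Term (ℕ ⊕ Fin n)) :=
  Or.inl ⟨x, by simp [FirstOrder.Language.Term.varFinsetLeft], rfl⟩

theorem mem_termOccs_func {n k : ℕ} (f : L.Functions k) (ts : Fin k → L.Term (ℕ ⊕ Fin n)) :
    Sum.inr (Sum.inl ⟨k, f⟩) ∈ termOccs (.func f ts) :=
  Or.inr ⟨_, Or.inl rfl, rfl⟩

theorem mem_occs_rel {n k : ℕ} (P : L.Relations k) (ts : Fin k → L.Term (ℕ ⊕ Fin n)) :
    Sum.inr (Sum.inr ⟨k, P⟩) ∈ occs (.rel P ts) :=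
  Or.inr ⟨_, Or.inl rfl, rfl⟩

theorem termIn_congr {M N : ℕ ⊕ L.Symbols → Tm Cst} {n : ℕ} (t : L.Term (ℕ ⊕ Fin n))
    (h : ∀ k ∈ termOccs t, M k = N k) : termIn M t = termIn N t := by
  induction t with
  | var k =>
    rcases k with x | i
    · simp only [termIn, h _ (mem_termOccs_var x)]
    · rfl
  | func f ts ih =>
    simp only [termIn, h _ (mem_termOccs_func f ts),
      fun i => ih i fun k hk => h k (termOccs_func_subset f ts i hk)]

theorem formIn_congr {M N : ℕ ⊕ L.Symbols → Tm Cst} {n : ℕ} (A : Form L n)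
    (h : ∀ k ∈ occs A, M k = N k) : formIn M A = formIn N A := by
  induction A with
  | rel P ts =>
    simp only [formIn, h _ (mem_occs_rel P ts),
      fun i => termIn_congr (ts i) fun k hk => h k (termOccs_rel_subset P ts i hk)]
  | imp A B hA hB =>
    simp only [formIn, hA fun k hk => h k (occs_imp_left A B hk),
      hB fun k hk => h k (occs_imp_right A B hk)]
  | all A hA => simp only [formIn, hA h]

/-- Translation of a term without bound variables. -/
def closedTermIn (M : ℕ ⊕ L.Symbols → Tm Cst) (t : L.Term ℕ) : Tm Cst :=
  termIn M (n := 0) (t.relabel Sum.inl)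

theorem termIn_relabel (M : ℕ ⊕ L.Symbols → Tm Cst) (n : ℕ) (t : L.Term ℕ) :
    termIn M (n := n) (t.relabel Sum.inl) = (closedTermIn M t).rename (· + n) := by
  have rename_zero (s : Tm Cst) : s.rename (· + 0) = s :=
    (Tm.rename_eq_subst _ _).trans (Tm.subst_var _)
  induction t with
  | var x => simp only [closedTermIn, FirstOrder.Language.Term.relabel, termIn, rename_zero]
  | func f ts ih =>
    simp only [closedTermIn, FirstOrder.Language.Term.relabel, termIn, rename_zero] at ih ⊢
    simp only [Tm.rename_eq_subst, Tm.apps_subst, List.map_ofFn, Function.comp_def] at ih ⊢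
    exact congrArg _ (congrArg _ (funext ih))

theorem rename_subst_upN_scons (n : ℕ) (s u : Tm Cst) :
    (s.rename (· + (n + 1))).subst (Tm.upN n (Tm.scons u Tm.var)) = s.rename (· + n) := by
  rw [Tm.subst_rename, Tm.rename_eq_subst]
  congr 1
  funext i
  rw [show i + (n + 1) = (i + 1) + n by omega, Tm.upN_add]
  rfl

theorem termIn_inst (M : ℕ ⊕ L.Symbols → Tm Cst) (u : L.Term ℕ) {n : ℕ}
    (t : L.Term (ℕ ⊕ Fin (n + 1))) :
    termIn M (t.subst (Sum.elim (fun x => .var (Sum.inl x))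
        (Fin.lastCases (u.relabel Sum.inl) (fun j => .var (Sum.inr j))))) =
      (termIn M t).subst (Tm.upN n (Tm.scons (closedTermIn M u) Tm.var)) := by
  induction t with
  | var k =>
    rcases k with x | j
    · simp only [FirstOrder.Language.Term.subst, Sum.elim_inl, termIn, rename_subst_upN_scons]
    · refine Fin.lastCases ?_ (fun j => ?_) j
      · simp only [FirstOrder.Language.Term.subst, Sum.elim_inr, Fin.lastCases_last,
          termIn_relabel, termIn, Tm.subst, Fin.val_last]
        -- Under `n` binders the outermost dangling variable has index `n`, that is, index `0`
        -- pushed under them.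
        have h := Tm.upN_add n (Tm.scons (closedTermIn M u) Tm.var) 0
        rw [Nat.zero_add] at h
        exact h.symm
      · simp only [FirstOrder.Language.Term.subst, Sum.elim_inr, Fin.lastCases_castSucc, termIn,
          Tm.subst, Fin.val_castSucc, Tm.upN_lt _ _ _ j.2]
  | func f ts ih =>
    simp only [FirstOrder.Language.Term.subst, termIn, Tm.apps_subst, rename_subst_upN_scons, List.map_ofFn,
      Function.comp_def, ih]

theorem formIn_inst_upN (M : ℕ ⊕ L.Symbols → Tm Cst) (u : L.Term ℕ) :
    {n : ℕ} → (A : Form L (n + 1)) → formIn M (A.inst u) =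
      (formIn M A).subst (Tm.upN n (Tm.scons (closedTermIn M u) Tm.var))
  | n, .rel P ts => by
    simp only [Form.inst, formIn, Tm.apps_subst, termIn_inst, List.map_ofFn,
      Function.comp_def, rename_subst_upN_scons]
  | _, .imp A B => by
    simp only [Form.inst, formIn, tImp, Tm.subst, formIn_inst_upN M u A, formIn_inst_upN M u B]
  | _, .all A => by
    simp only [Form.inst, formIn, tAll, tIota, tI, Tm.subst, formIn_inst_upN M u A, Tm.upN]

theorem formIn_inst (M : ℕ ⊕ L.Symbols → Tm Cst) (u : L.Term ℕ) (A : Form L 1) :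
    formIn M (A.inst u) = (formIn M A).inst (closedTermIn M u) :=
  (formIn_inst_upN M u A).trans (Tm.inst_eq _ _).symm

end Translation

/-! ## From natural deduction proofs to λΠ terms -/

namespace LPi

variable {C : Type} {S : Signature C} {R : Set (Tm C × Tm C)}

/-- `ξ` maps each declaration of `Γ` to a declaration of `Δ` of the corresponding type. -/
def IsRenaming (ξ : ℕ → ℕ) (Γ Δ : Ctx C) : Prop :=
  ∀ i T, Γ[i]? = some T → ∃ T', Δ[ξ i]? = some T' ∧
    T'.rename (· + (ξ i + 1)) = (T.rename (· + (i + 1))).rename ξ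

theorem IsRenaming.up {ξ : ℕ → ℕ} {Γ Δ : Ctx C} (h : IsRenaming ξ Γ Δ) (A : Tm C) :
    IsRenaming (Tm.upRen ξ) (A :: Γ) (A.rename ξ :: Δ) := by
  rintro (_ | i) T hT
  · cases hT
    refine ⟨_, rfl, ?_⟩
    simp only [Tm.rename_rename]
    rfl
  · obtain ⟨T', h₁, h₂⟩ := h i T hT
    refine ⟨T', h₁, ?_⟩
    have h₃ := congrArg (Tm.rename Nat.succ) h₂
    simp only [Tm.rename_rename] at h₃ ⊢
    exact h₃

/-- Well-formedness of the target context is assumed instead of derived, so the induction needs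
nothing from the well-formedness judgement and its motive is trivial. Constants keep their types
because these are closed. -/
theorem Typing.rename (hS : ∀ c A, (c, A) ∈ S → ∀ ξ, A.rename ξ = A) {Γ : Ctx C} {t A : Tm C}
    (h : Typing S R Γ t A) : ∀ {ξ : ℕ → ℕ} {Δ : Ctx C}, WellFormed S R Δ → IsRenaming ξ Γ Δ →
      Typing S R Δ (t.rename ξ) (A.rename ξ) := by
  refine Typing.rec (motive_1 := fun _ _ => True)
    (motive_2 := fun Γ t A _ => ∀ {ξ : ℕ → ℕ} {Δ : Ctx C}, WellFormed S R Δ → IsRenaming ξ Γ Δ →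
      Typing S R Δ (t.rename ξ) (A.rename ξ))
    trivial (fun _ _ => trivial) ?_ ?_ ?_ ?_ ?_ ?_ ?_ h
  · exact fun _ _ _ _ hΔ _ => .sort hΔ
  · intro Γ c A s _ h hc _ _ ξ Δ hΔ _
    rw [hS c A hc]
    exact .const hΔ h hc
  · intro Γ i A _ hi _ ξ Δ hΔ hξ
    obtain ⟨T', h₁, h₂⟩ := hξ i A hi
    rw [← h₂]
    exact .var hΔ h₁
  · intro Γ A B s _ _ hA hB ξ Δ hΔ hξ
    exact .prod (hA hΔ hξ) (hB (.decl (hA hΔ hξ)) (hξ.up A))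
  · intro Γ A B t s _ _ _ hA hB ht ξ Δ hΔ hξ
    have hΔ' := WellFormed.decl (hA hΔ hξ)
    exact .abs (hA hΔ hξ) (hB hΔ' (hξ.up A)) (ht hΔ' (hξ.up A))
  · intro Γ A B t u _ _ ht hu ξ Δ hΔ hξ
    rw [Tm.inst_rename]
    exact .app (ht hΔ hξ) (hu hΔ hξ)
  · intro Γ A B t s _ _ hAB ht hB ξ Δ hΔ hξ
    exact .conv (ht hΔ hξ) (hB hΔ hξ) (hAB.rename ξ)

theorem isRenaming_append (Θ Γ : Ctx C) : IsRenaming (· + Θ.length) Γ (Θ ++ Γ) := by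
  intro i T hT
  refine ⟨T, ?_, ?_⟩
  · rw [List.getElem?_append_right (Nat.le_add_left _ _), Nat.add_sub_cancel, hT]
  · rw [Tm.rename_rename]
    congr 1
    funext j
    simp only
    omega

theorem typing_var_zero {A : Tm C} {Γ : Ctx C} (h : WellFormed S R (A :: Γ)) :
    Typing S R (A :: Γ) (.var 0) (A.rename Nat.succ) :=
  Typing.var (i := 0) (A := A) h rfl

-- Weakening and derived typing rules of the theory

namespace Min

theorem sig_closed (c : Cst) (A : Tm Cst) (h : (c, A) ∈ sig) (ξ : ℕ → ℕ) : A.rename ξ = A := by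
  simp only [sig, List.mem_cons, List.not_mem_nil, or_false, Prod.mk.injEq] at h
  rcases h with ⟨-, rfl⟩ | ⟨-, rfl⟩ | ⟨-, rfl⟩ | ⟨-, rfl⟩ | ⟨-, rfl⟩ | ⟨-, rfl⟩ | ⟨-, rfl⟩ |
    ⟨-, rfl⟩ <;> rfl

theorem weaken {Ξ : Ctx Cst} {t T A : Tm Cst} (ht : Typing sig rules Ξ t T)
    (hA : WellFormed sig rules (A :: Ξ)) :
    Typing sig rules (A :: Ξ) (t.rename Nat.succ) (T.rename Nat.succ) :=
  ht.rename sig_closed hA (isRenaming_append [A] Ξ)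

theorem weaken_append {Ξ : Ctx Cst} {t T : Tm Cst} (ht : Typing sig rules Ξ t T) (Θ : Ctx Cst)
    (hΘ : WellFormed sig rules (Θ ++ Ξ)) :
    Typing sig rules (Θ ++ Ξ) (t.rename (· + Θ.length)) (T.rename (· + Θ.length)) :=
  ht.rename sig_closed hΘ (isRenaming_append Θ Ξ)

section

variable {Ξ : Ctx Cst}

theorem typing_I (h : WellFormed sig rules Ξ) : Typing sig rules Ξ tI (.sort .type) :=
  .const h (.sort .empty) (by simp [sig])

theorem typing_set (h : WellFormed sig rules Ξ) : Typing sig rules Ξ tSet (.sort .type) :=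
  .const h (.sort .empty) (by simp [sig])

theorem typing_prop (h : WellFormed sig rules Ξ) : Typing sig rules Ξ tProp (.sort .type) :=
  .const h (.sort .empty) (by simp [sig])

theorem typing_iota (h : WellFormed sig rules Ξ) : Typing sig rules Ξ tIota tSet :=
  .const h (typing_set .empty) (by simp [sig])

theorem typing_arrow {A B : Tm Cst} {s : Srt} (hA : Typing sig rules Ξ A (.sort .type))
    (hB : Typing sig rules Ξ B (.sort s)) : Typing sig rules Ξ (.arrow A B) (.sort s) :=
  .prod hA (weaken hB (.decl hA))

theorem typing_app {A B t u : Tm Cst} (ht : Typing sig rules Ξ t (.arrow A B))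
    (hu : Typing sig rules Ξ u A) : Typing sig rules Ξ (.app t u) B := by
  have h := Typing.app ht hu
  rwa [Tm.rename_succ_inst] at h

theorem typing_El (h : WellFormed sig rules Ξ) {a : Tm Cst} (ha : Typing sig rules Ξ a tSet) :
    Typing sig rules Ξ (tEl a) (.sort .type) :=
  typing_app (.const h (typing_arrow (typing_set .empty) (.sort .empty)) (by simp [sig])) ha

theorem typing_Prf (h : WellFormed sig rules Ξ) {p : Tm Cst} (hp : Typing sig rules Ξ p tProp) :
    Typing sig rules Ξ (tPrf p) (.sort .type) :=
  typing_app (.const h (typing_arrow (typing_prop .empty) (.sort .empty)) (by simp [sig])) hp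

theorem typing_imp (h : WellFormed sig rules Ξ) {p q : Tm Cst} (hp : Typing sig rules Ξ p tProp)
    (hq : Typing sig rules Ξ q tProp) : Typing sig rules Ξ (tImp p q) tProp :=
  typing_app (typing_app (.const h (typing_arrow (typing_prop .empty)
    (typing_arrow (typing_prop .empty) (typing_prop .empty))) (by simp [sig])) hp) hq

theorem typing_all (h : WellFormed sig rules Ξ) {a p : Tm Cst} (ha : Typing sig rules Ξ a tSet)
    (hp : Typing sig rules Ξ p (.arrow (tEl a) tProp)) :
    Typing sig rules Ξ (tAll a p) tProp := by
  have hS : WellFormed sig rules [tSet] := .decl (typing_set .empty)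
  have hV : Typing sig rules [tSet] (.var 0) tSet := typing_var_zero hS
  have hc := Typing.app (.const (c := .all) h (.prod (typing_set .empty) (typing_arrow
    (typing_arrow (typing_El hS hV) (typing_prop hS)) (typing_prop hS))) (by simp [sig])) ha
  exact typing_app hc hp

end

theorem conv_Prf_imp (p q : Tm Cst) :
    Conv rules (tPrf (tImp p q)) (.arrow (tPrf p) (tPrf q)) :=
  .of_step (step_imp p q)

/-- The rule for `∀` leaves the domain `El ι`, which rewrites to `I`, and a β-redex applying the
shifted abstraction to the new variable; contracting it undoes the shift. -/
theorem conv_Prf_all (a : Tm Cst) :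
    Conv rules (tPrf (tAll tIota (.lam tI a))) (.pi tI (tPrf a)) := by
  refine (Conv.of_step (step_all _ _)).trans (.pi (.of_step step_El) (.app (.refl _) ?_))
  have h := Conv.beta (R := rules) (tI.rename Nat.succ) (a.rename (Tm.upRen Nat.succ)) (.var 0)
  rwa [Tm.rename_upRen_succ_inst] at h

end Min

end LPi

namespace Translation

open LPi LPi.Min MinLogic

variable {L : FirstOrder.Language.{u, v}}

/-- The type of the λΠ term that stands for a free variable or a symbol. -/
def declType : ℕ ⊕ L.Symbols → Tm Cst
  | Sum.inl _ => tI
  | Sum.inr s => symbolType s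

theorem rename_arity {T : Tm Cst} {ξ : ℕ → ℕ} (hT : T.rename ξ = T) (k : ℕ) :
    (arity T k).rename ξ = arity T k := by
  induction k with
  | zero => exact hT
  | succ k ih => rw [arity, Tm.rename_arrow, ih]; rfl

theorem rename_declType (k : ℕ ⊕ L.Symbols) (ξ : ℕ → ℕ) :
    (declType k).rename ξ = declType k := by
  rcases k with x | f | P
  · rfl
  · exact rename_arity rfl _
  · exact rename_arity rfl _

theorem typing_arity {Ξ : Ctx Cst} (h : WellFormed sig rules Ξ) {T : Tm Cst}
    (hT : Typing sig rules Ξ T (.sort .type)) (k : ℕ) :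
    Typing sig rules Ξ (arity T k) (.sort .type) := by
  induction k with
  | zero => exact hT
  | succ k ih => exact typing_arrow (typing_I h) ih

theorem typing_declType {Ξ : Ctx Cst} (h : WellFormed sig rules Ξ) (k : ℕ ⊕ L.Symbols) :
    Typing sig rules Ξ (declType k) (.sort .type) := by
  rcases k with x | f | P
  · exact typing_I h
  · exact typing_arity h (typing_I h) _
  · exact typing_arity h (typing_prop h) _

theorem typing_apps {Ξ : Ctx Cst} {T : Tm Cst} {k : ℕ} {t : Tm Cst}
    (ht : Typing sig rules Ξ t (arity T k)) (us : Fin k → Tm Cst)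
    (hus : ∀ i, Typing sig rules Ξ (us i) tI) :
    Typing sig rules Ξ (Tm.apps t (List.ofFn us)) T := by
  induction k generalizing t with
  | zero => exact ht
  | succ k ih =>
    rw [List.ofFn_succ]
    exact ih (typing_app ht (hus 0)) _ fun i => hus i.succ

/-- Constant functions with value `d` work. They interpret the symbols that the context does not
declare. -/
theorem exists_typing_arity {Ξ : Ctx Cst} (h : WellFormed sig rules Ξ) {T d : Tm Cst}
    (hT : Typing sig rules Ξ T (.sort .type)) (hd : Typing sig rules Ξ d T) (k : ℕ) :
    ∃ t, Typing sig rules Ξ t (arity T k) := by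
  induction k with
  | zero => exact ⟨d, hd⟩
  | succ k ih =>
    obtain ⟨t, ht⟩ := ih
    have hI := WellFormed.decl (typing_I h)
    exact ⟨_, .abs (typing_I h) (weaken (typing_arity h hT k) hI) (weaken ht hI)⟩

theorem typing_termIn {Ξ : Ctx Cst} {M : ℕ ⊕ L.Symbols → Tm Cst} {n : ℕ}
    (hΞ : WellFormed sig rules (List.replicate n tI ++ Ξ)) (t : L.Term (ℕ ⊕ Fin n))
    (hM : ∀ k ∈ termOccs t, Typing sig rules Ξ (M k) (declType k)) :
    Typing sig rules (List.replicate n tI ++ Ξ) (termIn M t) tI := by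
  have hw (k) (hk : k ∈ termOccs t) := weaken_append (hM k hk) _ hΞ
  simp only [rename_declType, List.length_replicate] at hw
  induction t with
  | var k =>
    rcases k with x | i
    · exact hw _ (mem_termOccs_var x)
    · refine Typing.var hΞ (i := i) (A := tI) ?_
      rw [List.getElem?_append_left (by simp), List.getElem?_replicate_of_lt i.2]
  | func f ts ih =>
    exact typing_apps (hw _ (mem_termOccs_func f ts)) _ fun i =>
      ih i (fun k hk => hM k (termOccs_func_subset f ts i hk))
        (fun k hk => hw k (termOccs_func_subset f ts i hk))

theorem typing_formIn {Ξ : Ctx Cst} {M : ℕ ⊕ L.Symbols → Tm Cst} {n : ℕ}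
    (hΞ : WellFormed sig rules (List.replicate n tI ++ Ξ)) (A : Form L n)
    (hM : ∀ k ∈ occs A, Typing sig rules Ξ (M k) (declType k)) :
    Typing sig rules (List.replicate n tI ++ Ξ) (formIn M A) tProp := by
  induction A with
  | @rel n k P ts =>
    have hw := weaken_append (hM _ (mem_occs_rel P ts)) _ hΞ
    simp only [rename_declType, List.length_replicate] at hw
    exact typing_apps hw _ fun i =>
      typing_termIn hΞ (ts i) fun k hk => hM k (termOccs_rel_subset P ts i hk)
  | imp A B hA hB =>
    exact typing_imp hΞ (hA hΞ fun k hk => hM k (occs_imp_left A B hk))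
      (hB hΞ fun k hk => hM k (occs_imp_right A B hk))
  | all A hA =>
    have hΞ' := WellFormed.decl (typing_I hΞ)
    have h : Typing sig rules _ (.lam tI (formIn M A)) (.arrow tI tProp) :=
      .abs (typing_I hΞ) (typing_prop hΞ') (hA hΞ' hM)
    have hι := typing_iota hΞ
    -- The abstraction has type `I → Prop`, whereas `∀ ι` expects `El ι → Prop`.
    exact typing_all hΞ hι (.conv h (typing_arrow (typing_El hΞ hι) (typing_prop hΞ))
      (.pi (.symm (.of_step step_El)) (.refl _)))

/-- A natural deduction proof can be read in every λΠ context and environment in which its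
hypotheses are inhabited. -/
theorem exists_proofTerm {As : List (Form L 0)} {A : Form L 0} (h : Provable As A) :
    ∀ {Ξ : Ctx Cst} {M : ℕ ⊕ L.Symbols → Tm Cst}, WellFormed sig rules Ξ →
      (∀ k, Typing sig rules Ξ (M k) (declType k)) →
      (∀ C ∈ As, ∃ π, Typing sig rules Ξ π (tPrf (formIn M C))) →
      ∃ π, Typing sig rules Ξ π (tPrf (formIn M A)) := by
  induction h with
  | ax h => exact fun _ _ hAs => hAs _ h
  | @impIntro As A B _ ih =>
    intro Ξ M hΞ hM hAs
    have hA := typing_Prf hΞ (typing_formIn (n := 0) hΞ A fun k _ => hM k)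
    have hB := typing_Prf hΞ (typing_formIn (n := 0) hΞ B fun k _ => hM k)
    have hΞ' := WellFormed.decl hA
    have hPrf (C : Form L 0) : (tPrf (formIn M C)).rename Nat.succ =
        tPrf (formIn (fun k => (M k).rename Nat.succ) C) := by
      rw [← formIn_rename]
      rfl
    obtain ⟨π, hπ⟩ := ih hΞ' (M := fun k => (M k).rename Nat.succ)
      (fun k => by simpa only [rename_declType] using weaken (hM k) hΞ') (by
        intro C hC
        rw [← hPrf]
        rcases List.mem_cons.1 hC with rfl | hC
        · exact ⟨_, typing_var_zero hΞ'⟩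
        · obtain ⟨π, hπ⟩ := hAs C hC
          exact ⟨_, weaken hπ hΞ'⟩)
    rw [← hPrf] at hπ
    have hAB := typing_formIn (n := 0) hΞ (.imp A B) fun k _ => hM k
    exact ⟨_, .conv (.abs hA (weaken hB hΞ') hπ) (typing_Prf hΞ hAB) (conv_Prf_imp _ _).symm⟩
  | @impElim As A B _ _ ihAB ihA =>
    intro Ξ M hΞ hM hAs
    obtain ⟨π, hπ⟩ := ihAB hΞ hM hAs
    obtain ⟨π', hπ'⟩ := ihA hΞ hM hAs
    have hA := typing_Prf hΞ (typing_formIn (n := 0) hΞ A fun k _ => hM k)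
    have hB := typing_Prf hΞ (typing_formIn (n := 0) hΞ B fun k _ => hM k)
    exact ⟨_, typing_app (.conv hπ (typing_arrow hA hB) (conv_Prf_imp _ _)) hπ'⟩
  | @allIntro As A x hx hxA _ ih =>
    classical
    intro Ξ M hΞ hM hAs
    have hΞ' := WellFormed.decl (typing_I hΞ)
    let M₁ : ℕ ⊕ L.Symbols → Tm Cst := fun k => (M k).rename Nat.succ
    -- The eigenvariable is read as the variable just declared, whatever `M` assigned to it outside.
    let M₂ : ℕ ⊕ L.Symbols → Tm Cst := Function.update M₁ (Sum.inl x) (.var 0)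
    have hM₁ (k) : Typing sig rules (tI :: Ξ) (M₁ k) (declType k) := by
      simpa only [rename_declType] using weaken (hM k) hΞ'
    have hM₂ (k) : Typing sig rules (tI :: Ξ) (M₂ k) (declType k) := by
      rcases eq_or_ne k (Sum.inl x) with rfl | hk
      · simp only [M₂, Function.update_self]
        exact typing_var_zero hΞ'
      · simp only [M₂, Function.update_of_ne hk]
        exact hM₁ k
    -- By the eigenvariable condition, neither the hypotheses nor `A` notice the update.
    have hfresh {n : ℕ} (C : Form L n) (hC : x ∉ C.freeVars) : formIn M₂ C = formIn M₁ C := by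
      refine formIn_congr C fun k hk => Function.update_of_ne ?_ _ _
      rintro rfl
      rcases hk with ⟨y, hy, h⟩ | ⟨s, _, h⟩
      · cases h; exact hC hy
      · cases h
    obtain ⟨π, hπ⟩ := ih hΞ' hM₂ (by
      intro C hC
      obtain ⟨π, hπ⟩ := hAs C hC
      rw [hfresh C (hx C hC), ← formIn_rename]
      exact ⟨_, weaken hπ hΞ'⟩)
    have hA : formIn M₁ A = (formIn M A).rename (Tm.upRen Nat.succ) := by
      rw [Tm.rename_eq_subst, ← Tm.up_var_comp]
      refine Eq.trans ?_ (formIn_subst_upN M (fun i => .var (Nat.succ i)) A).symm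
      simp only [M₁, Tm.rename_eq_subst]
    have hx₂ : closedTermIn M₂ (.var x) = .var 0 := by
      simp only [closedTermIn, FirstOrder.Language.Term.relabel, termIn, M₂,
        Function.update_self]
      rfl
    rw [formIn_inst, hfresh A hxA, hx₂, hA, Tm.rename_upRen_succ_inst] at hπ
    have hall := typing_formIn (n := 0) hΞ (.all A) fun k _ => hM k
    have hA' := typing_formIn (n := 1) hΞ' A fun k _ => hM k
    exact ⟨_, .conv (.abs (typing_I hΞ) (typing_Prf hΞ' hA') hπ) (typing_Prf hΞ hall)
      (conv_Prf_all _).symm⟩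
  | @allElim As A t _ ih =>
    intro Ξ M hΞ hM hAs
    obtain ⟨π, hπ⟩ := ih hΞ hM hAs
    have hΞ' := WellFormed.decl (typing_I hΞ)
    have hA' := typing_formIn (n := 1) hΞ' A fun k _ => hM k
    -- The term `t` may use names absent from the sequent; hence the requirement that `M` be well
    -- typed on every name.
    have ht := typing_termIn (n := 0) hΞ (t.relabel Sum.inl) fun k _ => hM k
    rw [formIn_inst]
    exact ⟨_, .app (.conv hπ (.prod (typing_I hΞ) (typing_Prf hΞ' hA')) (conv_Prf_all _)) ht⟩

/-! ### The context of a sequent -/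

/-- The free variables and symbols that are declared by `Γ` and `Δ`. -/
def declared (Γ : List L.Symbols) (Δ : List ℕ) : Set (ℕ ⊕ L.Symbols) :=
  {k | Sum.elim (· ∈ Δ) (· ∈ Γ) k}

theorem occs_subset_declared {Γ : List L.Symbols} {Δ : List ℕ} {A : Form L 0}
    (hs : ∀ s ∈ A.symbols, s ∈ Γ) (hx : ∀ x ∈ A.freeVars, x ∈ Δ) : occs A ⊆ declared Γ Δ := by
  rintro k (⟨x, h, rfl⟩ | ⟨s, h, rfl⟩)
  · exact hx x h
  · exact hs s h

theorem context_getElem? (Γ : List L.Symbols) (Δ : List ℕ) (As : List (Form L 0)) (j : ℕ) :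
    (context Γ Δ As)[As.length + j]? = (Δ.map (fun _ => tI) ++ Γ.map symbolType)[j]? := by
  induction As with
  | nil => simp only [context, List.length_nil, Nat.zero_add]
  | cons A As ih =>
    rw [← ih, context, List.length_cons, Nat.add_right_comm, List.getElem?_cons_succ]

theorem context_getElem?_index (Γ : List L.Symbols) (Δ : List ℕ) (As : List (Form L 0))
    {k : ℕ ⊕ L.Symbols} (hk : k ∈ declared Γ Δ) :
    (context Γ Δ As)[index Γ Δ As.length k]? = some (declType k) := by
  rcases k with x | s
  · have hk : x ∈ Δ := hk
    have hlt := List.idxOf_lt_length_iff.2 hk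
    simp only [index]
    rw [context_getElem?, List.getElem?_append_left (by simpa using hlt), List.getElem?_map,
      List.getElem?_eq_getElem hlt]
    rfl
  · let _ : DecidableEq L.Symbols := Classical.decEq L.Symbols
    have hk : s ∈ Γ := hk
    have hlt := List.idxOf_lt_length_iff.2 hk
    simp only [index]
    rw [Nat.add_assoc, context_getElem?, List.getElem?_append_right (by simp), List.length_map,
      Nat.add_sub_cancel_left, List.getElem?_map, List.getElem?_eq_getElem hlt,
      List.getElem_idxOf hlt]
    rfl

theorem typing_var_index {Γ : List L.Symbols} {Δ : List ℕ} {As : List (Form L 0)}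
    (h : WellFormed sig rules (context Γ Δ As)) {k : ℕ ⊕ L.Symbols} (hk : k ∈ declared Γ Δ) :
    Typing sig rules (context Γ Δ As) (.var (index Γ Δ As.length k)) (declType k) := by
  have h := Typing.var h (context_getElem?_index Γ Δ As hk)
  rwa [rename_declType] at h

theorem wellFormed_context {Γ : List L.Symbols} {Δ : List ℕ} {As : List (Form L 0)}
    (hAs : ∀ A ∈ As, occs A ⊆ declared Γ Δ) : WellFormed sig rules (context Γ Δ As) := by
  induction As with
  | nil =>
    rw [context]
    induction Δ with
    | nil =>
      induction Γ with
      | nil => exact .empty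
      | cons s Γ ih => exact .decl (typing_declType (ih (by simp)) (Sum.inr s))
    | cons x Δ ih => exact .decl (typing_I (ih (by simp)))
  | cons A As ih =>
    have h := ih fun C hC => hAs C (List.mem_cons_of_mem _ hC)
    rw [context, form_eq_formIn]
    exact .decl (typing_Prf h (typing_formIn (n := 0) h A
      fun k hk => typing_var_index h (hAs A List.mem_cons_self hk)))

theorem index_add (Γ : List L.Symbols) (Δ : List ℕ) (m : ℕ) (k : ℕ ⊕ L.Symbols) :
    index Γ Δ (m + 1) k = index Γ Δ m k + 1 := by
  rcases k with x | s <;> simp only [index] <;> omega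

theorem exists_typing_hypothesis {Γ : List L.Symbols} {Δ : List ℕ} {As : List (Form L 0)}
    (hAs : ∀ A ∈ As, occs A ⊆ declared Γ Δ) {C : Form L 0} (hC : C ∈ As) :
    ∃ π, Typing sig rules (context Γ Δ As) π (tPrf (form (index Γ Δ As.length) C)) := by
  induction As with
  | nil => cases hC
  | cons A As ih =>
    have hwf := wellFormed_context hAs
    -- Each hypothesis is translated relative to the context below it; one more proof variable
    -- raises every index by one.
    have shift (C : Form L 0) : tPrf (form (index Γ Δ (A :: As).length) C) =
        (tPrf (form (index Γ Δ As.length) C)).rename Nat.succ := by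
      simp only [List.length_cons, form_eq_formIn, tPrf, Tm.rename, formIn_rename, index_add]
    rw [shift]
    rw [context] at hwf ⊢
    rcases List.mem_cons.1 hC with rfl | hC
    · exact ⟨_, typing_var_zero hwf⟩
    · obtain ⟨π, hπ⟩ := ih (fun C hC => hAs C (List.mem_cons_of_mem _ hC)) hC
      exact ⟨_, weaken hπ hwf⟩

/-- The environment is completed outside the declared names by arbitrary inhabitants. They disappear
from the final type, since only declared names occur in `B`. -/
theorem exists_isProofTerm {Γ : List L.Symbols} {Δ : List ℕ} {As : List (Form L 0)}
    {B : Form L 0} (hAs : ∀ A ∈ As, occs A ⊆ declared Γ Δ) (hB : occs B ⊆ declared Γ Δ)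
    (hne : Δ ≠ [] ∨ ∃ c : L.Functions 0, Sum.inl ⟨0, c⟩ ∈ Γ) (h : Provable As B) :
    ∃ π, IsProofTerm Γ Δ As B π := by
  have hwf := wellFormed_context hAs
  obtain ⟨d, hd⟩ : ∃ d, Typing sig rules (context Γ Δ As) d tI := by
    rcases hne with h | ⟨c, hc⟩
    · obtain ⟨x, hx⟩ := List.exists_mem_of_ne_nil Δ h
      exact ⟨_, typing_var_index hwf (k := Sum.inl x) hx⟩
    · exact ⟨_, typing_var_index hwf (k := Sum.inr (Sum.inl ⟨0, c⟩)) hc⟩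
  -- The translation of `B` supplies an inhabitant of `Prop` for undeclared predicate symbols.
  have hb := typing_formIn (n := 0) hwf B fun k hk => typing_var_index hwf (hB hk)
  have hM (k : ℕ ⊕ L.Symbols) : ∃ m, Typing sig rules (context Γ Δ As) m (declType k) ∧
      (k ∈ declared Γ Δ → m = .var (index Γ Δ As.length k)) := by
    by_cases hk : k ∈ declared Γ Δ
    · exact ⟨_, typing_var_index hwf hk, fun _ => rfl⟩
    · obtain ⟨m, hm⟩ : ∃ m, Typing sig rules (context Γ Δ As) m (declType k) := by
        rcases k with x | f | P
        · exact ⟨d, hd⟩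
        · exact exists_typing_arity hwf (typing_I hwf) hd _
        · exact exists_typing_arity hwf (typing_prop hwf) hb _
      exact ⟨m, hm, fun h => absurd h hk⟩
  choose M hM hM' using hM
  have hform (C : Form L 0) (hC : occs C ⊆ declared Γ Δ) :
      formIn M C = form (index Γ Δ As.length) C := by
    rw [form_eq_formIn]
    exact formIn_congr C fun k hk => hM' k (hC hk)
  obtain ⟨π, hπ⟩ := exists_proofTerm h hwf hM fun C hC => by
    rw [hform C (hAs C hC)]
    exact exists_typing_hypothesis hAs hC
  rw [hform B hB] at hπ
  exact ⟨π, hπ⟩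

end Translation

/-! ## From λΠ terms to natural deduction proofs

Types are interpreted by sets of raw terms, together with a forcing relation on these terms whose
worlds are lists of hypotheses. -/

namespace LPi

/-- Both sides are β-reducts of one abstraction applied to `d` and to `d'`. The type annotation is
irrelevant, and `d` is used for it. -/
theorem Conv.inst_right {C : Type} {R : Set (Tm C × Tm C)} (t : Tm C) {d d' : Tm C}
    (h : Conv R d d') : Conv R (t.inst d) (t.inst d') :=
  (Conv.beta d t d).symm.trans ((Conv.app (.refl _) h).trans (.beta d t d'))

theorem Conv.apps {C : Type} {R : Set (Tm C × Tm C)} {k : ℕ} {us vs : Fin k → Tm C} {t t' : Tm C}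
    (ht : Conv R t t') (h : ∀ i, Conv R (us i) (vs i)) :
    Conv R (Tm.apps t (List.ofFn us)) (Tm.apps t' (List.ofFn vs)) := by
  induction k generalizing t t' with
  | zero => exact ht
  | succ k ih =>
    rw [List.ofFn_succ, List.ofFn_succ]
    exact ih (.app ht (h 0)) fun i => h i.succ

theorem Tm.apps_var_inj {C : Type} {i j : ℕ} {us vs : List (Tm C)}
    (h : apps (var i) us = apps (var j) vs) : i = j ∧ us = vs := by
  induction us using List.reverseRecOn generalizing vs with
  | nil =>
    cases vs using List.reverseRecOn with
    | nil => cases h; exact ⟨rfl, rfl⟩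
    | append_singleton vs v => simp [apps] at h
  | append_singleton us u ih =>
    cases vs using List.reverseRecOn with
    | nil => simp [apps] at h
    | append_singleton vs v =>
      simp only [apps, List.foldl_append, List.foldl_cons, List.foldl_nil, app.injEq] at h
      obtain ⟨rfl, rfl⟩ := ih h.1
      exact ⟨rfl, by rw [h.2]⟩

theorem Min.Algebraic.apps {us : List (Tm Cst)} (h : ∀ u ∈ us, Algebraic u) {t : Tm Cst}
    (ht : Algebraic t) : Algebraic (Tm.apps t us) := by
  induction us generalizing t with
  | nil => exact ht
  | cons u us ih =>
    exact ih (fun v hv => h v (List.mem_cons_of_mem _ hv)) (.app ht (h u List.mem_cons_self))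

end LPi

namespace Translation

open LPi LPi.Min MinLogic

variable {L : FirstOrder.Language.{u, v}}

/-! ### Codes of atomic propositions -/

/-- An index for each free variable and each symbol in `Γ`. -/
noncomputable def codeIndex (Γ : List L.Symbols) : ℕ ⊕ L.Symbols → ℕ
  | Sum.inl x => Γ.length + x
  | Sum.inr s =>
      letI : DecidableEq L.Symbols := Classical.decEq L.Symbols
      Γ.idxOf s

/-- The environment that maps each free variable and each symbol in `Γ` to a λΠ variable of its
own. -/
noncomputable def code (Γ : List L.Symbols) (k : ℕ ⊕ L.Symbols) : Tm Cst :=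
  .var (codeIndex Γ k)

/-- Symbols occupy the indices below `Γ.length` and variables those from there on. A symbol outside
`Γ` would get index `Γ.length` and collide with the variable `0`, hence the hypotheses. -/
theorem codeIndex_inj {Γ : List L.Symbols} {k k' : ℕ ⊕ L.Symbols}
    (hk : ∀ s, k = Sum.inr s → s ∈ Γ) (hk' : ∀ s, k' = Sum.inr s → s ∈ Γ)
    (h : codeIndex Γ k = codeIndex Γ k') : k = k' := by
  let _ : DecidableEq L.Symbols := Classical.decEq L.Symbols
  rcases k with x | s <;> rcases k' with y | s' <;> simp only [codeIndex] at h
  · rw [Nat.add_left_cancel h]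
  · have := List.idxOf_lt_length_iff.2 (hk' s' rfl)
    omega
  · have := List.idxOf_lt_length_iff.2 (hk s rfl)
    omega
  · rw [(List.idxOf_inj (hk s rfl)).1 h]

/-- The terms in which only the symbols of `Γ` occur. -/
abbrev TermOver {α : Type} (Γ : List L.Symbols) (t : L.Term α) : Prop :=
  termSymbols t ⊆ {s | s ∈ Γ}

theorem TermOver.arg {α : Type} {Γ : List L.Symbols} {k : ℕ} {f : L.Functions k}
    {ts : Fin k → L.Term α} (h : TermOver Γ (.func f ts)) (i : Fin k) : TermOver Γ (ts i) :=
  (Set.subset_iUnion (fun i => termSymbols (ts i)) i).trans (Set.subset_union_right.trans h)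

theorem TermOver.head {α : Type} {Γ : List L.Symbols} {k : ℕ} {f : L.Functions k}
    {ts : Fin k → L.Term α} (h : TermOver Γ (.func f ts)) : Sum.inl ⟨k, f⟩ ∈ Γ :=
  h (Or.inl rfl)

theorem termIn_code_var (Γ : List L.Symbols) (x : ℕ) :
    termIn (code Γ) (n := 0) (.var (Sum.inl x)) = Tm.apps (.var (codeIndex Γ (Sum.inl x))) [] :=
  rfl

theorem termIn_code_func (Γ : List L.Symbols) {k : ℕ} (f : L.Functions k)
    (ts : Fin k → L.Term (ℕ ⊕ Fin 0)) :
    termIn (code Γ) (n := 0) (.func f ts) =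
      Tm.apps (.var (codeIndex Γ (Sum.inr (Sum.inl ⟨k, f⟩))))
        (List.ofFn fun i => termIn (code Γ) (ts i)) :=
  rfl

theorem formIn_code_rel (Γ : List L.Symbols) {k : ℕ} (P : L.Relations k)
    (ts : Fin k → L.Term (ℕ ⊕ Fin 0)) :
    formIn (code Γ) (n := 0) (.rel P ts) =
      Tm.apps (.var (codeIndex Γ (Sum.inr (Sum.inr ⟨k, P⟩))))
        (List.ofFn fun i => termIn (code Γ) (ts i)) :=
  rfl

theorem termIn_code_inj {Γ : List L.Symbols} {t t' : L.Term (ℕ ⊕ Fin 0)} (ht : TermOver Γ t)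
    (ht' : TermOver Γ t') (h : termIn (code Γ) t = termIn (code Γ) t') : t = t' := by
  induction t generalizing t' with
  | var k =>
    rcases k with x | i
    · rcases t' with (y | i) | ⟨g, ts'⟩
      · rw [termIn_code_var, termIn_code_var] at h
        cases codeIndex_inj (by simp) (by simp) (Tm.apps_var_inj h).1
        rfl
      · exact i.elim0
      · rw [termIn_code_var, termIn_code_func] at h
        have h := (Tm.apps_var_inj h).1
        cases codeIndex_inj (by simp) (by rintro s ⟨⟩; exact ht'.head) h
    · exact i.elim0
  | func f ts ih =>
    rcases t' with (y | i) | ⟨g, ts'⟩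
    · rw [termIn_code_var, termIn_code_func] at h
      have h := (Tm.apps_var_inj h).1
      cases codeIndex_inj (by rintro s ⟨⟩; exact ht.head) (by simp) h
    · exact i.elim0
    · rw [termIn_code_func, termIn_code_func] at h
      obtain ⟨h₁, h₂⟩ := Tm.apps_var_inj h
      have h₁ := codeIndex_inj (by rintro s ⟨⟩; exact ht.head) (by rintro s ⟨⟩; exact ht'.head) h₁
      cases h₁
      have h₃ := List.ofFn_injective h₂
      congr 1
      funext i
      exact ih i (ht.arg i) (ht'.arg i) (congrFun h₃ i)

theorem algebraic_termIn_code (Γ : List L.Symbols) (t : L.Term (ℕ ⊕ Fin 0)) :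
    Algebraic (termIn (code Γ) t) := by
  induction t with
  | var k =>
    rcases k with x | i
    · exact .var _
    · exact i.elim0
  | func f ts ih =>
    rw [termIn_code_func]
    refine .apps (fun u hu => ?_) (.var _)
    obtain ⟨i, rfl⟩ := (List.mem_ofFn' _ _).1 hu
    exact ih i

/-- `A` is an atomic proposition in which only the symbols of `Γ` occur. -/
inductive IsAtom (Γ : List L.Symbols) : Form L 0 → Prop
  | rel {k : ℕ} (P : L.Relations k) (ts : Fin k → L.Term (ℕ ⊕ Fin 0)) :
      Sum.inr ⟨k, P⟩ ∈ Γ → (∀ i, TermOver Γ (ts i)) → IsAtom Γ (.rel P ts)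

theorem IsAtom.algebraic {Γ : List L.Symbols} {A : Form L 0} (h : IsAtom Γ A) :
    Algebraic (formIn (code Γ) A) := by
  obtain ⟨P, ts, -, -⟩ := h
  rw [formIn_code_rel]
  refine .apps (fun u hu => ?_) (.var _)
  obtain ⟨i, rfl⟩ := (List.mem_ofFn' _ _).1 hu
  exact algebraic_termIn_code Γ _

/-- An atom can be recovered from its code, so a base type `Prf p` has only one interpretation. -/
theorem IsAtom.formIn_inj {Γ : List L.Symbols} {A A' : Form L 0} (h : IsAtom Γ A)
    (h' : IsAtom Γ A') (heq : formIn (code Γ) A = formIn (code Γ) A') : A = A' := by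
  obtain ⟨P, ts, hP, hts⟩ := h
  obtain ⟨P', ts', hP', hts'⟩ := h'
  rw [formIn_code_rel, formIn_code_rel] at heq
  obtain ⟨h₁, h₂⟩ := Tm.apps_var_inj heq
  have h₁ := codeIndex_inj (by rintro s ⟨⟩; exact hP) (by rintro s ⟨⟩; exact hP') h₁
  cases h₁
  congr 1
  funext i
  exact termIn_code_inj (hts i) (hts' i) (congrFun (List.ofFn_injective h₂) i)

/-! ### The interpretation of types -/

/-- A set of terms with a forcing relation. -/
@[ext]
structure Sem (L : FirstOrder.Language.{u, v}) where
  /-- The elements of the interpretation. -/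
  car : Tm Cst → Prop
  /-- The elements that are forced under a list of hypotheses. -/
  real : Tm Cst → List (Form L 0) → Prop

namespace Sem

/-- Gives `choose!` a default value for families of interpretations outside their domain. -/
instance : Nonempty (Sem L) := ⟨⟨fun _ => True, fun _ _ => True⟩⟩

/-- The interpretation of a type whose elements are all forced. -/
def data (S : Tm Cst → Prop) : Sem L := ⟨S, fun _ _ => True⟩

/-- The interpretation of a product. -/
def pi (X : Sem L) (Y : Tm Cst → Sem L) : Sem L where
  car f := ∀ d, X.car d → (Y d).car (.app f d)
  real f w := ∀ w', w ⊆ w' → ∀ d, X.car d → X.real d w' → (Y d).real (.app f d) w'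

/-- The interpretation of the type `I`: the codes of the first-order terms. -/
def ind (Γ : List L.Symbols) : Sem L :=
  data fun d => ∃ t : L.Term ℕ, TermOver Γ t ∧ Conv rules d (closedTermIn (code Γ) t)

/-- The interpretation of the type `Prf A`, if `A` is atomic. -/
def prf (A : Form L 0) : Sem L where
  car _ := True
  real _ w := ∀ w', w ⊆ w' → Provable w' A

/-- The interpretation of `I → ⋯ → I → T` with `k` arguments. -/
def arity (Γ : List L.Symbols) (X : Sem L) : ℕ → Sem L
  | 0 => X
  | k + 1 => pi (ind Γ) fun _ => arity Γ X k

end Sem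

/-- The interpretation of types generated by the interpretation `base` of base types. -/
inductive Interp (base : Tm Cst → Sem L → Prop) : Tm Cst → Sem L → Prop
  | base {A A₀ : Tm Cst} {X : Sem L} : Conv rules A A₀ → base A₀ X → Interp base A X
  | pi {A A₁ B₁ : Tm Cst} {X : Sem L} {Y : Tm Cst → Sem L} : Conv rules A (.pi A₁ B₁) →
      Interp base A₁ X → (∀ d, X.car d → Interp base (B₁.inst d) (Y d)) →
      Interp base A (.pi X Y)

/-- The conditions on an interpretation of base types. -/
structure IsBase (base : Tm Cst → Sem L → Prop) : Prop where
  normal : ∀ {A X}, base A X → Normal A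
  ne_pi : ∀ {A X}, base A X → ∀ B C, A ≠ .pi B C
  unique : ∀ {A X X'}, base A X → base A X' → X = X'
  car_conv : ∀ {A X d d'}, base A X → Conv rules d d' → X.car d → X.car d'
  real_conv : ∀ {A X d d' w}, base A X → Conv rules d d' → X.real d w → X.real d' w
  mono : ∀ {A X d w w'}, base A X → w ⊆ w' → X.real d w → X.real d w'

namespace Interp

variable {base : Tm Cst → Sem L → Prop}

theorem of_base {A : Tm Cst} {X : Sem L} (h : base A X) : Interp base A X := .base (.refl _) h

theorem conv {A A' : Tm Cst} {X : Sem L} (h : Interp base A X) (hA : Conv rules A' A) :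
    Interp base A' X := by
  cases h with
  | base h hX => exact .base (hA.trans h) hX
  | pi h hX hY => exact .pi (hA.trans h) hX hY

theorem lift {base' : Tm Cst → Sem L → Prop} (hb : ∀ A X, base A X → base' A X) {A : Tm Cst}
    {X : Sem L} (h : Interp base A X) : Interp base' A X := by
  induction h with
  | base h hX => exact .base h (hb _ _ hX)
  | pi h _ _ ihX ihY => exact .pi h ihX ihY

/-- Convertible normal base types are equal and never convertible to a product, so both derivations
end with the same constructor; for products, injectivity passes the conversion to the components. -/
theorem unique (hb : IsBase base) {A : Tm Cst} {X : Sem L} (h : Interp base A X) :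
    ∀ {A' : Tm Cst} {X' : Sem L}, Interp base A' X' → Conv rules A A' → X = X' := by
  induction h with
  | base h hX =>
    intro A' X' h' hA
    cases h' with
    | base h' hX' =>
      have heq := (hb.normal hX).eq_of_conv (hb.normal hX') (h.symm.trans (hA.trans h'))
      subst heq
      exact hb.unique hX hX'
    | pi h' _ _ =>
      exact absurd (h.symm.trans (hA.trans h')) ((hb.normal hX).not_conv_pi (hb.ne_pi hX) _ _)
  | @pi A A₁ B₁ X Y h hX hY ihX ihY =>
    intro A' X' h' hA
    cases h' with
    | base h' hX' =>
      exact absurd (h'.symm.trans (hA.symm.trans h))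
        ((hb.normal hX').not_conv_pi (hb.ne_pi hX') _ _)
    | @pi _ A₂ B₂ X' Y' h' hX' hY' =>
      obtain ⟨h₁, h₂⟩ := conv_pi_inj (h.symm.trans (hA.trans h'))
      obtain rfl := ihX hX' h₁
      -- The two families agree only on the elements of the domain, which is all that `Sem.pi`
      -- inspects.
      have hYY' (d) (hd : X.car d) : Y d = Y' d := ihY d hd (hY' d hd) (h₂.inst d)
      ext f
      · exact forall₂_congr fun d hd => by rw [hYY' d hd]
      · exact forall₂_congr fun w hw => forall₂_congr fun d hd => by rw [hYY' d hd]

theorem car_conv (hb : IsBase base) {A : Tm Cst} {X : Sem L} (h : Interp base A X) {d d' : Tm Cst}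
    (hd : Conv rules d d') : X.car d → X.car d' := by
  induction h generalizing d d' with
  | base _ hX => exact hb.car_conv hX hd
  | pi _ _ _ _ ihY => exact fun hf e he => ihY e he (hd.app (.refl e)) (hf e he)

theorem real_conv (hb : IsBase base) {A : Tm Cst} {X : Sem L} (h : Interp base A X)
    {d d' : Tm Cst} {w : List (Form L 0)} (hd : Conv rules d d') : X.real d w → X.real d' w := by
  induction h generalizing d d' w with
  | base _ hX => exact hb.real_conv hX hd
  | pi _ _ _ _ ihY =>
    exact fun hf w' hw e he hr => ihY e he (hd.app (.refl e)) (hf w' hw e he hr)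

theorem mono (hb : IsBase base) {A : Tm Cst} {X : Sem L} (h : Interp base A X) {d : Tm Cst}
    {w w' : List (Form L 0)} (hw : w ⊆ w') : X.real d w → X.real d w' := by
  cases h with
  | base _ hX => exact hb.mono hX hw
  | pi _ _ _ => exact fun hf w'' hw' => hf w'' (List.Subset.trans hw hw')

theorem arrow {A B : Tm Cst} {X Y : Sem L} (hX : Interp base A X) (hY : Interp base B Y) :
    Interp base (.arrow A B) (.pi X fun _ => Y) :=
  .pi (.refl _) hX fun d _ => by rwa [Tm.rename_succ_inst]

end Interp

/-- The extension of `base` with a base type `c` whose elements are those of `S`. -/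
inductive Extend (base : Tm Cst → Sem L → Prop) (c : Tm Cst) (S : Tm Cst → Prop) :
    Tm Cst → Sem L → Prop
  | old {A : Tm Cst} {X : Sem L} : base A X → Extend base c S A X
  | new : Extend base c S c (.data S)

theorem IsBase.extend {base : Tm Cst → Sem L → Prop} (hb : IsBase base) {c : Tm Cst}
    {S : Tm Cst → Prop} (hc : Normal c) (hpi : ∀ B C, c ≠ .pi B C) (hfresh : ∀ X, ¬ base c X)
    (hS : ∀ {d d'}, Conv rules d d' → S d → S d') : IsBase (Extend base c S) where
  normal h := by
    cases h with
    | old h => exact hb.normal h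
    | new => exact hc
  ne_pi h := by
    cases h with
    | old h => exact hb.ne_pi h
    | new => exact hpi
  unique h h' := by
    cases h with
    | old h =>
      cases h' with
      | old h' => exact hb.unique h h'
      | new => exact absurd h (hfresh _)
    | new =>
      cases h' with
      | old h' => exact absurd h' (hfresh _)
      | new => rfl
  car_conv h := by
    cases h with
    | old h => exact hb.car_conv h
    | new => exact hS
  real_conv h := by
    cases h with
    | old h => exact hb.real_conv h
    | new => exact fun _ _ => trivial
  mono h := by
    cases h with
    | old h => exact hb.mono h
    | new => exact fun _ _ => trivial

/-- The types `I`, `Set` and `Prf A` with `A` atomic. -/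
inductive BasePrf (Γ : List L.Symbols) : Tm Cst → Sem L → Prop
  | ind : BasePrf Γ (.const .I) (.ind Γ)
  | set : BasePrf Γ (.const .set) (.data fun d => Conv rules d tIota)
  | prf {A : Form L 0} {p : Tm Cst} : IsAtom Γ A → p = formIn (code Γ) A →
      BasePrf Γ (.app (.const .Prf) p) (.prf A)

/-- The types of `BasePrf`, and `Prop`. -/
def BaseType (Γ : List L.Symbols) : Tm Cst → Sem L → Prop :=
  Extend (BasePrf Γ) tProp fun p => ∃ Z, Interp (BasePrf Γ) (tPrf p) Z

/-- The types of `BaseType`, and `TYPE`. -/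
def BaseKind (Γ : List L.Symbols) : Tm Cst → Sem L → Prop :=
  Extend (BaseType Γ) (.sort .type) fun A => ∃ Z, Interp (BaseType Γ) A Z

/-- The types of `BaseKind`, and `KIND`. -/
def BaseTop (Γ : List L.Symbols) : Tm Cst → Sem L → Prop :=
  Extend (BaseKind Γ) (.sort .kind) fun A => ∃ Z, Interp (BaseKind Γ) A Z

section Base

variable (Γ : List L.Symbols)

theorem isBase_basePrf : IsBase (BasePrf Γ) where
  normal h := by
    cases h with
    | ind => exact normal_const _
    | set => exact normal_const _
    | prf h hp => subst hp; exact h.algebraic.normal_prf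
  ne_pi h := by cases h <;> simp
  unique h h' := by
    cases h with
    | ind => cases h'; rfl
    | set => cases h'; rfl
    | prf h hp =>
      cases h' with
      | prf h' hp' => rw [h.formIn_inj h' (hp.symm.trans hp')]
  car_conv h := by
    cases h with
    | ind => exact fun hd ⟨t, ht, h⟩ => ⟨t, ht, hd.symm.trans h⟩
    | set => exact fun hd h => hd.symm.trans h
    | prf => exact fun _ _ => trivial
  real_conv h := by
    cases h with
    | ind => exact fun _ _ => trivial
    | set => exact fun _ _ => trivial
    | prf => exact fun _ h => h
  mono h := by
    cases h with
    | ind => exact fun _ _ => trivial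
    | set => exact fun _ _ => trivial
    | prf => exact fun hw h w' hw' => h w' (List.Subset.trans hw hw')

theorem isBase_baseType : IsBase (BaseType Γ) :=
  (isBase_basePrf Γ).extend (normal_const _) (by simp [tProp]) (fun X h => by cases h)
    fun hd ⟨Z, hZ⟩ => ⟨Z, hZ.conv (.app (.refl _) hd.symm)⟩

theorem isBase_baseKind : IsBase (BaseKind Γ) :=
  (isBase_baseType Γ).extend (normal_sort _) (by simp)
    (fun X h => by cases h with | old h => cases h)
    fun hd ⟨Z, hZ⟩ => ⟨Z, hZ.conv hd.symm⟩

theorem isBase_baseTop : IsBase (BaseTop Γ) :=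
  (isBase_baseKind Γ).extend (normal_sort _) (by simp)
    (fun X h => by cases h with | old h => cases h with | old h => cases h)
    fun hd ⟨Z, hZ⟩ => ⟨Z, hZ.conv hd.symm⟩

variable {Γ} {A : Tm Cst} {X : Sem L}

theorem Interp.toType (h : Interp (BasePrf Γ) A X) : Interp (BaseType Γ) A X :=
  h.lift fun _ _ => .old

theorem Interp.toKind (h : Interp (BaseType Γ) A X) : Interp (BaseKind Γ) A X :=
  h.lift fun _ _ => .old

theorem Interp.toTop (h : Interp (BaseKind Γ) A X) : Interp (BaseTop Γ) A X :=
  h.lift fun _ _ => .old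

variable (Γ)

theorem interp_I : Interp (BasePrf Γ) tI (.ind Γ) := .of_base .ind

theorem interp_set : Interp (BasePrf Γ) tSet (.data fun d => Conv rules d tIota) := .of_base .set

theorem interp_prop : Interp (BaseType Γ) tProp
    (.data fun p => ∃ Z, Interp (BasePrf Γ) (tPrf p) Z) := .of_base .new

theorem interp_type : Interp (BaseKind Γ) (.sort .type)
    (.data fun A => ∃ Z, Interp (BaseType Γ) A Z) := .of_base .new

theorem interp_kind : Interp (BaseTop Γ) (.sort .kind)
    (.data fun A => ∃ Z, Interp (BaseKind Γ) A Z) := .of_base .new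

variable {Γ}

/-- As `Set` contains only terms convertible to `ι`, every `El d` is convertible to `I`. -/
theorem interp_El {d : Tm Cst} (hd : Conv rules d tIota) : Interp (BasePrf Γ) (tEl d) (.ind Γ) :=
  (interp_I Γ).conv ((Conv.app (.refl _) hd).trans (.of_step step_El))

theorem interp_Prf_imp {p q : Tm Cst} (hp : ∃ Z, Interp (BasePrf Γ) (tPrf p) Z)
    (hq : ∃ Z, Interp (BasePrf Γ) (tPrf q) Z) : ∃ Z, Interp (BasePrf Γ) (tPrf (tImp p q)) Z := by
  obtain ⟨X, hX⟩ := hp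
  obtain ⟨Y, hY⟩ := hq
  exact ⟨_, (hX.arrow hY).conv (conv_Prf_imp p q)⟩

/-- The quantifier ranges over codes of first-order terms and not over `Prop`, so the product stays
in the lowest layer. -/
theorem interp_Prf_all {a p : Tm Cst} (ha : Conv rules a tIota)
    (hp : ∀ d, (Sem.ind Γ).car d → ∃ Z, Interp (BasePrf Γ) (tPrf (.app p d)) Z) :
    ∃ Z, Interp (BasePrf Γ) (tPrf (tAll a p)) Z := by
  choose! Y hY using hp
  refine ⟨_, .pi (Y := Y) (.of_step (step_all a p)) (interp_El ha) fun d hd => ?_⟩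
  have h : (tPrf (.app (p.rename Nat.succ) (.var 0))).inst d = tPrf (.app p d) :=
    congrArg (fun q => tPrf (.app q d)) (Tm.rename_succ_inst p d)
  rw [h]
  exact hY d hd

/-- A constant belongs to the interpretation of its type, and is forced. -/
theorem interp_const {c : Cst} {A : Tm Cst} (h : (c, A) ∈ sig) (θ : ℕ → Tm Cst) :
    ∃ X, Interp (BaseTop Γ) (A.subst θ) X ∧ X.car (.const c) ∧ ∀ w, X.real (.const c) w := by
  simp only [sig, List.mem_cons, List.not_mem_nil, or_false, Prod.mk.injEq] at h
  rcases h with ⟨rfl, rfl⟩ | ⟨rfl, rfl⟩ | ⟨rfl, rfl⟩ | ⟨rfl, rfl⟩ | ⟨rfl, rfl⟩ | ⟨rfl, rfl⟩ |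
    ⟨rfl, rfl⟩ | ⟨rfl, rfl⟩
  · exact ⟨_, (interp_type Γ).toTop, ⟨_, (interp_I Γ).toType⟩, fun _ => trivial⟩
  · exact ⟨_, (interp_type Γ).toTop, ⟨_, (interp_set Γ).toType⟩, fun _ => trivial⟩
  · exact ⟨_, ((interp_set Γ).toType.toKind.arrow (interp_type Γ)).toTop,
      fun d hd => ⟨_, (interp_El hd).toType⟩, fun _ _ _ _ _ _ => trivial⟩
  · exact ⟨_, (interp_set Γ).toType.toKind.toTop, .refl _, fun _ => trivial⟩
  · exact ⟨_, (interp_type Γ).toTop, ⟨_, interp_prop Γ⟩, fun _ => trivial⟩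
  · exact ⟨_, ((interp_prop Γ).toKind.arrow (interp_type Γ)).toTop,
      fun p ⟨Z, hZ⟩ => ⟨Z, hZ.toType⟩, fun _ _ _ _ _ _ => trivial⟩
  · exact ⟨_, ((interp_prop Γ).arrow ((interp_prop Γ).arrow (interp_prop Γ))).toKind.toTop,
      fun p hp q hq => interp_Prf_imp hp hq, fun _ _ _ _ _ _ _ _ _ _ _ => trivial⟩
  · refine ⟨_, Interp.toTop <| Interp.toKind <| .pi (.refl _) (interp_set Γ).toType
      (Y := fun _ => .pi (.pi (.ind Γ) fun _ => .data fun p => ∃ Z, Interp (BasePrf Γ) (tPrf p) Z)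
        fun _ => .data fun p => ∃ Z, Interp (BasePrf Γ) (tPrf p) Z)
      fun d hd => ((interp_El hd).toType.arrow (interp_prop Γ)).arrow (interp_prop Γ),
      fun a ha p hp => interp_Prf_all ha hp, fun _ _ _ _ _ _ _ _ _ _ _ => trivial⟩

end Base

/-! ### Soundness of the interpretation -/

/-- `θ` maps the variables of `Ξ` to elements of the interpretations of their types. -/
def Models (Γ : List L.Symbols) (θ : ℕ → Tm Cst) (Ξ : Ctx Cst) : Prop :=
  ∀ i T, Ξ[i]? = some T →
    ∃ X, Interp (BaseTop Γ) ((T.rename (· + (i + 1))).subst θ) X ∧ X.car (θ i)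

/-- The terms that `θ` assigns to the variables of `Ξ` are forced at `w`. -/
def Forces (Γ : List L.Symbols) (θ : ℕ → Tm Cst) (Ξ : Ctx Cst) (w : List (Form L 0)) : Prop :=
  ∀ i T, Ξ[i]? = some T →
    ∀ X, Interp (BaseTop Γ) ((T.rename (· + (i + 1))).subst θ) X → X.real (θ i) w

theorem subst_rename_add_scons (T d : Tm Cst) (θ : ℕ → Tm Cst) (i : ℕ) :
    (T.rename (· + (i + 1 + 1))).subst (Tm.scons d θ) = (T.rename (· + (i + 1))).subst θ := by
  simp only [Tm.subst_rename]
  rfl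

theorem subst_rename_one_scons (T d : Tm Cst) (θ : ℕ → Tm Cst) :
    (T.rename (· + (0 + 1))).subst (Tm.scons d θ) = T.subst θ := by
  simp only [Tm.subst_rename]
  rfl

section Soundness

variable {Γ : List L.Symbols} {θ : ℕ → Tm Cst} {Ξ : Ctx Cst} {A d : Tm Cst} {X : Sem L}

theorem Models.cons (h : Models Γ θ Ξ) (hX : Interp (BaseTop Γ) (A.subst θ) X) (hd : X.car d) :
    Models Γ (Tm.scons d θ) (A :: Ξ) := by
  rintro (_ | i) T hT
  · cases hT
    rw [subst_rename_one_scons]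
    exact ⟨X, hX, hd⟩
  · rw [subst_rename_add_scons]
    exact h i T hT

theorem Forces.cons {w : List (Form L 0)} (h : Forces Γ θ Ξ w)
    (hX : Interp (BaseTop Γ) (A.subst θ) X) (hd : X.real d w) :
    Forces Γ (Tm.scons d θ) (A :: Ξ) w := by
  rintro (_ | i) T hT Z hZ
  · cases hT
    rw [subst_rename_one_scons] at hZ
    rwa [hZ.unique (isBase_baseTop Γ) hX (.refl _)]
  · rw [subst_rename_add_scons] at hZ
    exact h i T hT Z hZ

theorem Forces.mono {w w' : List (Form L 0)} (h : Forces Γ θ Ξ w) (hw : w ⊆ w') :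
    Forces Γ θ Ξ w' :=
  fun i T hT X hX => hX.mono (isBase_baseTop Γ) hw (h i T hT X hX)

/-- By uniqueness, any interpretation of `TYPE` is the intended one. -/
theorem interp_of_sort_type (hX : Interp (BaseTop Γ) (.sort .type) X) (hA : X.car A) :
    ∃ Z, Interp (BaseType Γ) A Z := by
  rw [hX.unique (isBase_baseTop Γ) (interp_type Γ).toTop (.refl _)] at hA
  exact hA

theorem interp_of_sort {s : Srt} (hX : Interp (BaseTop Γ) (.sort s) X) (hA : X.car A) :
    ∃ Z, Interp (BaseKind Γ) A Z := by
  cases s with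
  | type =>
    obtain ⟨Z, hZ⟩ := interp_of_sort_type hX hA
    exact ⟨Z, hZ.toKind⟩
  | kind =>
    rw [hX.unique (isBase_baseTop Γ) (interp_kind Γ) (.refl _)] at hA
    exact hA

end Soundness

/-- The interpretation is sound for typing. -/
theorem interp_of_typing (Γ : List L.Symbols) {Ξ : Ctx Cst} {t A : Tm Cst}
    (h : Typing sig rules Ξ t A) : ∀ {θ : ℕ → Tm Cst}, Models Γ θ Ξ →
      ∃ X, Interp (BaseTop Γ) (A.subst θ) X ∧ X.car (t.subst θ) ∧
        ∀ w, Forces Γ θ Ξ w → X.real (t.subst θ) w := by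
  refine Typing.rec (motive_1 := fun _ _ => True)
    (motive_2 := fun Ξ t A _ => ∀ {θ : ℕ → Tm Cst}, Models Γ θ Ξ →
      ∃ X, Interp (BaseTop Γ) (A.subst θ) X ∧ X.car (t.subst θ) ∧
        ∀ w, Forces Γ θ Ξ w → X.real (t.subst θ) w)
    trivial (fun _ _ => trivial) ?_ ?_ ?_ ?_ ?_ ?_ ?_ h
  · exact fun _ _ _ _ => ⟨_, interp_kind Γ, ⟨_, interp_type Γ⟩, fun _ _ => trivial⟩
  · intro Ξ c A s _ _ hc _ _ θ _
    obtain ⟨X, hX, hcar, hreal⟩ := interp_const (Γ := Γ) hc θ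
    exact ⟨X, hX, hcar, fun w _ => hreal w⟩
  · intro Ξ i A _ hi _ θ hθ
    obtain ⟨X, hX, hcar⟩ := hθ i A hi
    exact ⟨X, hX, hcar, fun w hw => hw i A hi X hX⟩
  · intro Ξ A B s _ _ hA hB θ hθ
    obtain ⟨_, hU, hcar, -⟩ := hA hθ
    obtain ⟨X, hX⟩ := interp_of_sort_type hU hcar
    have hB' (d) (hd : X.car d) := hB (hθ.cons hX.toKind.toTop hd)
    -- The sort of `B` decides the layer of the product: `BaseType` for `TYPE`, `BaseKind` for
    -- `KIND`.
    cases s with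
    | type =>
      have hY (d) (hd : X.car d) : ∃ Y, Interp (BaseType Γ) ((B.subst (Tm.up θ)).inst d) Y := by
        obtain ⟨_, hU, hcar, -⟩ := hB' d hd
        rw [Tm.subst_up_inst]
        exact interp_of_sort_type hU hcar
      choose! Y hY using hY
      exact ⟨_, (interp_type Γ).toTop, ⟨_, .pi (.refl _) hX hY⟩, fun _ _ => trivial⟩
    | kind =>
      have hY (d) (hd : X.car d) : ∃ Y, Interp (BaseKind Γ) ((B.subst (Tm.up θ)).inst d) Y := by
        obtain ⟨_, hU, hcar, -⟩ := hB' d hd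
        rw [Tm.subst_up_inst]
        exact interp_of_sort hU hcar
      choose! Y hY using hY
      exact ⟨_, interp_kind Γ, ⟨_, .pi (.refl _) hX.toKind hY⟩, fun _ _ => trivial⟩
  · intro Ξ A B t s _ _ _ hA _ ht θ hθ
    obtain ⟨_, hU, hcar, -⟩ := hA hθ
    obtain ⟨X, hX⟩ := interp_of_sort_type hU hcar
    have hX := hX.toKind.toTop
    have ht' (d) (hd : X.car d) := ht (hθ.cons hX hd)
    choose! Y hY hcarY hrealY using ht'
    -- Membership and forcing, known for the body at `d`, are carried back to the β-redex by closure
    -- under conversion.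
    have hbeta (d) : Conv rules (t.subst (Tm.scons d θ)) (.app ((Tm.lam A t).subst θ) d) := by
      rw [← Tm.subst_up_inst]
      exact (Conv.beta _ _ _).symm
    refine ⟨_, .pi (.refl _) hX (Y := Y) fun d hd => ?_, fun d hd => ?_,
      fun w hw w' hw' d hd hr => ?_⟩
    · rw [Tm.subst_up_inst]
      exact hY d hd
    · exact (hY d hd).car_conv (isBase_baseTop Γ) (hbeta d) (hcarY d hd)
    · exact (hY d hd).real_conv (isBase_baseTop Γ) (hbeta d)
        (hrealY d hd w' ((hw.mono hw').cons hX hr))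
  · intro Ξ A B t u _ _ ht hu θ hθ
    obtain ⟨Z, hZ, hcarZ, hrealZ⟩ := ht hθ
    obtain ⟨X, hX, hcarX, hrealX⟩ := hu hθ
    -- A product is not convertible to a base type, so its interpretation is a product; uniqueness
    -- identifies the domain with the interpretation of `A`.
    cases hZ with
    | base h hZ =>
      exact absurd h.symm (((isBase_baseTop Γ).normal hZ).not_conv_pi
        ((isBase_baseTop Γ).ne_pi hZ) _ _)
    | @pi _ A₁ B₁ X' Y h hX' hY =>
      obtain ⟨h₁, h₂⟩ := conv_pi_inj h
      obtain rfl := hX.unique (isBase_baseTop Γ) hX' h₁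
      refine ⟨Y (u.subst θ), ?_, hcarZ _ hcarX, fun w hw => ?_⟩
      · rw [Tm.inst_subst]
        exact (hY _ hcarX).conv (h₂.inst _)
      · exact hrealZ w hw w (List.Subset.refl w) _ hcarX (hrealX w hw)
  · intro Ξ A B t s _ _ hAB ht _ θ hθ
    obtain ⟨X, hX, h⟩ := ht hθ
    exact ⟨X, hX.conv (hAB.subst θ).symm, h⟩

/-! ### The interpretation of propositions -/

/-- Under the codes, the type of the proofs of `A` is interpreted by the provability of `A`. -/
theorem interp_formIn_code (Γ : List L.Symbols) (A : Form L 0)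
    (hA : A.symbols ⊆ {s | s ∈ Γ}) :
    ∃ X, Interp (BasePrf Γ) (tPrf (formIn (code Γ) A)) X ∧ (∀ d, X.car d) ∧
      ∀ d w, X.real d w ↔ ∀ w', w ⊆ w' → Provable w' A := by
  induction h : A.size using Nat.strong_induction_on generalizing A with
  | _ n ih =>
  subst h
  cases A with
  | rel P ts =>
    simp only [Form.symbols, Set.union_subset_iff, Set.iUnion_subset_iff] at hA
    exact ⟨_, .of_base (.prf (.rel P ts (hA.1 rfl) hA.2) rfl), fun _ => trivial,
      fun _ _ => Iff.rfl⟩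
  | imp A B =>
    simp only [Form.symbols, Set.union_subset_iff] at hA
    obtain ⟨X, hX, hcarX, hrealX⟩ := ih A.size (by simp only [Form.size]; omega) A hA.1 rfl
    obtain ⟨Y, hY, hcarY, hrealY⟩ := ih B.size (by simp only [Form.size]; omega) B hA.2 rfl
    refine ⟨_, (hX.arrow hY).conv (conv_Prf_imp _ _), fun d e _ => hcarY _, fun d w => ⟨?_, ?_⟩⟩
    · intro hf w' hw
      refine .impIntro ?_
      -- In the world extended by `A`, the type `Prf A` is forced by the axiom rule. Any term can be
      -- the argument, since all belong to `Prf A`.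
      have hr := hf (A :: w') (List.Subset.trans hw (List.subset_cons_self A w')) d (hcarX d)
        ((hrealX _ _).2 fun w'' hw' => .ax (hw' List.mem_cons_self))
      exact (hrealY _ _).1 hr _ (List.Subset.refl _)
    · intro h w' hw e _ hr
      exact (hrealY _ _).2 fun w'' hw' =>
        .impElim (h w'' (List.Subset.trans hw hw')) ((hrealX _ _).1 hr w'' hw')
  | all A =>
    simp only [Form.symbols] at hA
    have hY (d) (hd : (Sem.ind Γ).car d) : ∃ Y,
        Interp (BasePrf Γ) ((tPrf (formIn (code Γ) A)).inst d) Y ∧ (∀ e, Y.car e) ∧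
          ∀ t, TermOver Γ t → Conv rules d (closedTermIn (code Γ) t) →
            ∀ e w, Y.real e w ↔ ∀ w', w ⊆ w' → Provable w' (A.inst t) := by
      have key (t) (ht : TermOver Γ t) (hd : Conv rules d (closedTermIn (code Γ) t)) : ∃ Y,
          Interp (BasePrf Γ) ((tPrf (formIn (code Γ) A)).inst d) Y ∧ (∀ e, Y.car e) ∧
            ∀ e w, Y.real e w ↔ ∀ w', w ⊆ w' → Provable w' (A.inst t) := by
        obtain ⟨Y, hY, h⟩ := ih (A.inst t).size (by simp only [Form.size_inst, Form.size]; omega)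
          (A.inst t) (Form.symbols_inst ht A hA) rfl
        refine ⟨Y, hY.conv ((Conv.inst_right _ hd).trans ?_), h⟩
        rw [formIn_inst]
        exact .refl _
      obtain ⟨t, ht, hd⟩ := hd
      obtain ⟨Y, hY, hcar, -⟩ := key t ht hd
      refine ⟨Y, hY, hcar, fun t' ht' hd' => ?_⟩
      -- If `d` is convertible to the codes of both `t` and `t'`, the interpretations obtained from
      -- them coincide by uniqueness.
      obtain ⟨Y', hY', -, hreal⟩ := key t' ht' hd'
      rwa [hY.unique (isBase_basePrf Γ) hY' (.refl _)]
    choose! Y hY hcar hreal using hY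
    refine ⟨_, .pi (conv_Prf_all _) (interp_I Γ) hY, fun d e he => hcar e he _,
      fun d w => ⟨?_, ?_⟩⟩
    · intro hf w' hw
      -- A world is a finite list, so a variable fresh for it and for `A` exists. Forcing at the
      -- code of this variable gives the premiss of `∀`-introduction.
      have hfin : ((⋃ C ∈ {C | C ∈ w'}, C.freeVars) ∪ A.freeVars).Finite :=
        ((List.finite_toSet w').biUnion fun C _ => C.finite_freeVars).union A.finite_freeVars
      obtain ⟨x, hx⟩ := hfin.exists_notMem
      simp only [Set.mem_union, Set.mem_iUnion, not_or, not_exists, Set.mem_ofPred_eq] at hx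
      refine .allIntro x (fun C hC => hx.1 C hC) hx.2 ?_
      have hover : TermOver Γ (.var x : L.Term ℕ) := Set.empty_subset _
      have hx' : (Sem.ind Γ).car (closedTermIn (code Γ) (.var x)) := ⟨_, hover, .refl _⟩
      exact (hreal _ hx' _ hover (.refl _) _ _).1 (hf w' hw _ hx' trivial) _ (List.Subset.refl _)
    · intro h w' hw e he _
      obtain ⟨t, ht, hd⟩ := he
      exact (hreal e ⟨t, ht, hd⟩ t ht hd _ _).2 fun w'' hw' =>
        .allElim t (h w'' (List.Subset.trans hw hw'))

/-! ### The interpretation of the context of a sequent -/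

section Context

variable {Γ : List L.Symbols}

theorem Interp.arity {base : Tm Cst → Sem L → Prop} {T : Tm Cst} {X : Sem L}
    (hI : Interp base tI (.ind Γ)) (hT : Interp base T X) (k : ℕ) :
    Interp base (Translation.arity T k) (Sem.arity Γ X k) := by
  induction k with
  | zero => exact hT
  | succ k ih => exact hI.arrow ih

theorem Sem.car_arity {X : Sem L} {k : ℕ} {t : Tm Cst}
    (h : ∀ us : Fin k → Tm Cst, (∀ i, (Sem.ind Γ).car (us i)) → X.car (Tm.apps t (List.ofFn us))) :
    (Sem.arity Γ X k).car t := by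
  induction k generalizing t with
  | zero => exact h Fin.elim0 fun i => i.elim0
  | succ k ih =>
    refine fun d hd => ih fun us hus => ?_
    have := h (Fin.cons d us) (Fin.cases hd hus)
    rwa [List.ofFn_succ] at this

theorem Sem.real_arity {X : Sem L} (h : ∀ d w, X.real d w) (k : ℕ) (t : Tm Cst)
    (w : List (Form L 0)) : (Sem.arity Γ X k).real t w := by
  induction k generalizing t w with
  | zero => exact h t w
  | succ k ih => exact fun w' _ d _ _ => ih _ w'

/-- The code of a function symbol applied to codes of terms is a code of a term. The code of a
predicate symbol applied to them is the code of an atom, so it belongs to `Prop`. -/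
theorem interp_declType (k : ℕ ⊕ L.Symbols) (hk : ∀ s, k = Sum.inr s → s ∈ Γ) :
    ∃ X, Interp (BaseTop Γ) (declType k) X ∧ X.car (code Γ k) ∧ ∀ w, X.real (code Γ k) w := by
  have hI := interp_I Γ
  rcases k with x | ⟨k, f⟩ | ⟨k, P⟩
  · exact ⟨_, hI.toType.toKind.toTop, ⟨.var x, Set.empty_subset _, .refl _⟩, fun _ => trivial⟩
  · refine ⟨_, (hI.arity hI k).toType.toKind.toTop, Sem.car_arity fun us hus => ?_,
      Sem.real_arity (fun _ _ => trivial) k _⟩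
    choose ts hts hus using hus
    refine ⟨.func f ts, Set.union_subset ?_ (Set.iUnion_subset hts), Conv.apps (.refl _) hus⟩
    exact Set.singleton_subset_iff.2 (hk _ rfl)
  · refine ⟨_, (hI.toType.arity (interp_prop Γ) k).toKind.toTop, Sem.car_arity fun us hus => ?_,
      Sem.real_arity (fun _ _ => trivial) k _⟩
    choose ts hts hus using hus
    have hatom : IsAtom Γ (.rel P fun i => (ts i).relabel Sum.inl) :=
      .rel P _ (hk _ rfl) fun i => by
        rw [TermOver, termSymbols_relabel]
        exact hts i
    exact ⟨_, .base (.app (.refl _) (Conv.apps (.refl _) hus)) (.prf hatom rfl)⟩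

/-- The substitution that maps the index `i` to the element of index `i` of a list. -/
def substOfList : List (Tm Cst) → ℕ → Tm Cst
  | [] => Tm.var
  | d :: ds => Tm.scons d (substOfList ds)

theorem substOfList_eq {ds : List (Tm Cst)} {i : ℕ} {d : Tm Cst} (h : ds[i]? = some d) :
    substOfList ds i = d := by
  induction ds generalizing i with
  | nil => simp at h
  | cons e ds ih =>
    cases i with
    | zero => exact Option.some.inj h
    | succ i => exact ih h

/-- The terms assigned to the variables of the context of a sequent: proof variables are
irrelevant, and the others are mapped to their codes. -/
noncomputable def closingList (Γ : List L.Symbols) (Δ : List ℕ) (As : List (Form L 0)) :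
    List (Tm Cst) :=
  As.map (fun _ => .sort .type) ++
    (Δ.map (fun x => code Γ (Sum.inl x)) ++ Γ.map (fun s => code Γ (Sum.inr s)))

theorem closingList_index (Γ : List L.Symbols) (Δ : List ℕ) (As : List (Form L 0))
    {k : ℕ ⊕ L.Symbols} (hk : k ∈ declared Γ Δ) :
    substOfList (closingList Γ Δ As) (index Γ Δ As.length k) = code Γ k := by
  refine substOfList_eq ?_
  rcases k with x | s
  · have hk : x ∈ Δ := hk
    have hlt := List.idxOf_lt_length_iff.2 hk
    simp only [index, closingList]
    rw [List.getElem?_append_right (by simp), List.length_map, Nat.add_sub_cancel_left,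
      List.getElem?_append_left (by simpa using hlt), List.getElem?_map,
      List.getElem?_eq_getElem hlt, List.getElem_idxOf hlt]
    rfl
  · let _ : DecidableEq L.Symbols := Classical.decEq L.Symbols
    have hk : s ∈ Γ := hk
    have hlt := List.idxOf_lt_length_iff.2 hk
    simp only [index, closingList]
    rw [Nat.add_assoc, List.getElem?_append_right (by simp), List.length_map,
      Nat.add_sub_cancel_left, List.getElem?_append_right (by simp), List.length_map,
      Nat.add_sub_cancel_left, List.getElem?_map, List.getElem?_eq_getElem hlt,
      List.getElem_idxOf hlt]
    rfl

theorem subst_arity {T : Tm Cst} {θ : ℕ → Tm Cst} (hT : T.subst θ = T) (k : ℕ) :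
    (arity T k).subst θ = arity T k := by
  induction k with
  | zero => exact hT
  | succ k ih => rw [arity, Tm.subst_arrow, ih]; rfl

theorem subst_declType (k : ℕ ⊕ L.Symbols) (θ : ℕ → Tm Cst) :
    (declType k).subst θ = declType k := by
  rcases k with x | f | P
  · rfl
  · exact subst_arity rfl _
  · exact subst_arity rfl _

theorem models_nil (Γ : List L.Symbols) (θ : ℕ → Tm Cst) : Models Γ θ [] := by
  rintro i T hT
  simp at hT

theorem forces_nil (Γ : List L.Symbols) (θ : ℕ → Tm Cst) (w : List (Form L 0)) :
    Forces Γ θ [] w := by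
  rintro i T hT
  simp at hT

theorem models_cons_code {θ : ℕ → Tm Cst} {Ξ : Ctx Cst} {w : List (Form L 0)}
    (h : Models Γ θ Ξ ∧ Forces Γ θ Ξ w) (k : ℕ ⊕ L.Symbols) (hk : ∀ s, k = Sum.inr s → s ∈ Γ) :
    Models Γ (Tm.scons (code Γ k) θ) (declType k :: Ξ) ∧
      Forces Γ (Tm.scons (code Γ k) θ) (declType k :: Ξ) w := by
  obtain ⟨X, hX, hcar, hreal⟩ := interp_declType k hk
  rw [← subst_declType k θ] at hX
  exact ⟨h.1.cons hX hcar, h.2.cons hX (hreal w)⟩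

theorem subst_closingList (Γ : List L.Symbols) (Δ : List ℕ) (As : List (Form L 0)) {C : Form L 0}
    (hC : occs C ⊆ declared Γ Δ) :
    (tPrf (form (index Γ Δ As.length) C)).subst (substOfList (closingList Γ Δ As)) =
      tPrf (formIn (code Γ) C) := by
  refine congrArg tPrf ?_
  rw [form_eq_formIn, ← formIn_congr C fun k hk => closingList_index Γ Δ As (hC hk)]
  exact formIn_subst _ _ C

theorem symbols_subset {Δ : List ℕ} {C : Form L 0} (hC : occs C ⊆ declared Γ Δ) :
    C.symbols ⊆ {s | s ∈ Γ} :=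
  fun s hs => hC (Or.inr ⟨s, hs, rfl⟩)

/-- Proof variables are forced because their propositions belong to `w` and are thus axioms in every
extension. The world is kept independent of `As` so that the induction can shorten the list. -/
theorem models_context (Δ : List ℕ) (As : List (Form L 0)) (w : List (Form L 0))
    (hAs : ∀ A ∈ As, occs A ⊆ declared Γ Δ) (hw : As ⊆ w) :
    Models Γ (substOfList (closingList Γ Δ As)) (context Γ Δ As) ∧
      Forces Γ (substOfList (closingList Γ Δ As)) (context Γ Δ As) w := by
  induction As with
  | nil =>
    rw [context, closingList, List.map_nil, List.nil_append]
    clear hAs hw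
    induction Δ with
    | nil =>
      simp only [List.map_nil, List.nil_append]
      -- The induction shortens the list of declarations, while the codes still refer to all of `Γ`.
      have key (Γ' : List L.Symbols) (h : Γ' ⊆ Γ) :
          Models Γ (substOfList (Γ'.map fun s => code Γ (Sum.inr s))) (Γ'.map symbolType) ∧
            Forces Γ (substOfList (Γ'.map fun s => code Γ (Sum.inr s))) (Γ'.map symbolType) w := by
        induction Γ' with
        | nil => exact ⟨models_nil Γ _, forces_nil Γ _ w⟩
        | cons s Γ' ih =>
          refine models_cons_code (ih (List.subset_of_cons_subset h)) (Sum.inr s) ?_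
          rintro s ⟨⟩
          exact h List.mem_cons_self
      exact key Γ (List.Subset.refl Γ)
    | cons x Δ ih => exact models_cons_code ih (Sum.inl x) (by simp)
  | cons A As ih =>
    obtain ⟨hM, hF⟩ := ih (fun C hC => hAs C (List.mem_cons_of_mem _ hC))
      (List.subset_of_cons_subset hw)
    have hA := hAs A List.mem_cons_self
    obtain ⟨X, hX, hcar, hreal⟩ := interp_formIn_code Γ A (symbols_subset hA)
    rw [← subst_closingList Γ Δ As hA] at hX
    have hX := hX.toType.toKind.toTop
    rw [context]
    exact ⟨hM.cons hX (hcar _),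
      hF.cons hX ((hreal _ _).2 fun w' hw' => .ax (hw' (hw List.mem_cons_self)))⟩

/-- Soundness is applied at the world `As`, where the hypotheses hold; forcing of `Prf B` there,
read at the trivial extension, is provability of `B`. -/
theorem provable_of_isProofTerm {Δ : List ℕ} {As : List (Form L 0)} {B : Form L 0}
    (hAs : ∀ A ∈ As, occs A ⊆ declared Γ Δ) (hB : occs B ⊆ declared Γ Δ) {π : Tm Cst}
    (h : IsProofTerm Γ Δ As B π) : Provable As B := by
  obtain ⟨hM, hF⟩ := models_context Δ As As hAs (List.Subset.refl As)
  obtain ⟨X, hX, -, hr⟩ := interp_of_typing Γ h hM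
  obtain ⟨Y, hY, -, hreal⟩ := interp_formIn_code Γ B (symbols_subset hB)
  rw [subst_closingList Γ Δ As hB] at hX
  obtain rfl := hX.unique (isBase_baseTop Γ) hY.toType.toKind.toTop (.refl _)
  exact (hreal _ _).1 (hr As hF) As (List.Subset.refl As)

end Context

end Translation

/-- `Γ` lists the symbols of `L` that are declared in the context `Γ_L`; it is a full enumeration
of the symbols of `L` when `L` is finite, and in general any finite list of symbols that covers
those of the sequent. -/
theorem mainTheorem4 (L : FirstOrder.Language.{u, v})
    (As : List (MinLogic.Form L 0)) (B : MinLogic.Form L 0)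
    (Γ : List L.Symbols) (Δ : List ℕ) (hΓ : Γ.Nodup) (hΔ : Δ.Nodup)
    (hsymbols : ∀ A ∈ B :: As, ∀ s ∈ A.symbols, s ∈ Γ)
    (hvars : ∀ A ∈ B :: As, ∀ x ∈ A.freeVars, x ∈ Δ) :
    ((Δ ≠ [] ∨ ∃ c : L.Functions 0, Sum.inl ⟨0, c⟩ ∈ Γ) →
      (MinLogic.Provable As B ↔ ∃ π, Translation.IsProofTerm Γ Δ As B π)) ∧
    ((∃ π, Translation.IsProofTerm Γ Δ As B π) → MinLogic.Provable As B) := by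
  have hocc (A) (hA : A ∈ B :: As) : Translation.occs A ⊆ Translation.declared Γ Δ :=
    Translation.occs_subset_declared (hsymbols A hA) (hvars A hA)
  have hB := hocc B List.mem_cons_self
  have hAs (A) (hA : A ∈ As) := hocc A (List.mem_cons_of_mem B hA)
  have hif : (∃ π, Translation.IsProofTerm Γ Δ As B π) → MinLogic.Provable As B :=
    fun ⟨_, hπ⟩ => Translation.provable_of_isProofTerm hAs hB hπ
  exact ⟨fun hne => ⟨Translation.exists_isProofTerm hAs hB hne, hif⟩, hif⟩
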